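/- Let $\mathbb F=\mathbb C(q)$ with $q$ a formal parameter, let $[n]=\frac{q^n-q^{-n}}{q-q^{-1}}$ and $d=[2]=q+q^{-1}$. Let $\mathrm{TL}$ be the generic Temperley--Lieb category: its objects are the non-negative integers; $\mathrm{Hom}(m,n)$ is the $\mathbb F$-vector space spanned by the planar diagrams (up to planar isotopy) of disjoint arcs and loops in a square that join in pairs $m$ points on the bottom edge and $n$ points on the top edge, modulo the relation that a loop may be removed at the cost of a factor $d$ (so the diagrams without loops form a basis); composition is vertical stacking, and the tensor product is addition on objects and horizontal juxtaposition on diagrams. Define $p_n\in\mathrm{Hom}(n,n)$ by $p_0=\mathrm{id}_0$, $p_1=\mathrm{id}_1$ and $$p_{n+1}=(p_n\otimes \mathrm{id}_1)-\frac{[n]}{[n+1]}\,(p_n\otimes \mathrm{id}_1)\,U_n\,(p_n\otimes \mathrm{id}_1)\qquad(n\ge 1),$$ where $U_n\in\mathrm{Hom}(n+1,n+1)$ consists of $n-1$ vertical strands followed on the right by a cap on the bottom edge and a cup on the top edge. Then every $p_n$ is idempotent (the Jones--Wenzl idempotent), hence an object of the Karoubi envelope of $\mathrm{TL}$, in which $\mathrm{Hom}(p,p')$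 consists of the morphisms $f$ of $\mathrm{TL}$ with $fp=f=p'f$, and the tensor product of two idempotents is their tensor product in $\mathrm{TL}$. For all integers $a,b,c\ge 0$, the $\mathbb F$-vector space $\mathrm{Hom}(p_a\otimes p_b,p_c)$ in the Karoubi envelope is one-dimensional if and only if $(a,b,c)$ is admissible, that is, $a+b+c$ is even and $a+b\ge c$, $b+c\ge a$ and $a+c\ge b$; if $(a,b,c)$ is not admissible, then $\mathrm{Hom}(p_a\otimes p_b,p_c)=0$. -/

import Mathlib

namespace TemperleyLieb

section Glue

/-- The equivalence relation on `Y` generated by the images of an equivalence relation `r`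
along `φ` and of an equivalence relation `s` along `ψ`. -/
def glue {X₁ X₂ Y : Type} (φ : X₁ → Y) (ψ : X₂ → Y) (r : Setoid X₁) (s : Setoid X₂) : Setoid Y :=
  Relation.EqvGen.setoid fun y y' =>
    (∃ a b, r a b ∧ φ a = y ∧ φ b = y') ∨ (∃ a b, s a b ∧ ψ a = y ∧ ψ b = y')

/-- The number of classes of `r` that are met by the points satisfying `P`. -/
noncomputable def countOn {X : Type} (r : Setoid X) (P : X → Prop) : ℕ :=
  Nat.card (Quotient (r.comap (Subtype.val : {x // P x} → X)))

variable {X₁ X₂ X₃ X Y Z V W U : Type}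

theorem glue_left {φ : X₁ → Y} {ψ : X₂ → Y} {r : Setoid X₁} {s : Setoid X₂} {a b : X₁}
    (h : r a b) : glue φ ψ r s (φ a) (φ b) :=
  Relation.EqvGen.rel _ _ (Or.inl ⟨a, b, h, rfl, rfl⟩)

theorem glue_right {φ : X₁ → Y} {ψ : X₂ → Y} {r : Setoid X₁} {s : Setoid X₂} {a b : X₂}
    (h : s a b) : glue φ ψ r s (ψ a) (ψ b) :=
  Relation.EqvGen.rel _ _ (Or.inr ⟨a, b, h, rfl, rfl⟩)

theorem glue_le {φ : X₁ → Y} {ψ : X₂ → Y} {r : Setoid X₁} {s : Setoid X₂} {t : Setoid Y}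
    (h₁ : ∀ a b, r a b → t (φ a) (φ b)) (h₂ : ∀ a b, s a b → t (ψ a) (ψ b)) :
    ∀ {y y' : Y}, glue φ ψ r s y y' → t y y' := by
  intro y y' h
  induction h with
  | rel y y' h =>
    rcases h with ⟨a, b, hab, rfl, rfl⟩ | ⟨a, b, hab, rfl, rfl⟩
    · exact h₁ _ _ hab
    · exact h₂ _ _ hab
  | refl y => exact t.refl y
  | symm y y' _ ih => exact t.symm ih
  | trans x y z _ _ h1 h2 => exact t.trans h1 h2

theorem glue_comm (φ : X₁ → Y) (ψ : X₂ → Y) (r : Setoid X₁) (s : Setoid X₂) :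
    glue φ ψ r s = glue ψ φ s r := by
  ext y y'
  exact ⟨glue_le (fun _ _ => glue_right) (fun _ _ => glue_left),
    glue_le (fun _ _ => glue_right) (fun _ _ => glue_left)⟩

theorem glue_assoc {Y' : Type} (a : X₁ → Y) (b : X₂ → Y) (ψ : Y → Z) (b' : X₂ → Y')
    (c : X₃ → Y') (ψ' : Y' → Z) (h : ψ ∘ b = ψ' ∘ b')
    (r : Setoid X₁) (s : Setoid X₂) (t : Setoid X₃) :
    glue ψ (ψ' ∘ c) (glue a b r s) t = glue (ψ ∘ a) ψ' r (glue b' c s t) := by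
  have hb : ∀ x, ψ (b x) = ψ' (b' x) := fun x => congrFun h x
  ext z z'
  constructor
  · refine glue_le (fun y y' hy => ?_) (fun x x' hx => ?_)
    · refine glue_le (t := (glue (ψ ∘ a) ψ' r (glue b' c s t)).comap ψ) ?_ ?_ hy
      · exact fun x x' hx => glue_left (φ := ψ ∘ a) hx
      · intro x x' hx
        change glue _ _ _ _ (ψ (b x)) (ψ (b x'))
        rw [hb, hb]
        exact glue_right (glue_left hx)
    · exact glue_right (ψ := ψ') (glue_right hx)
  · refine glue_le (fun x x' hx => ?_) (fun y y' hy => ?_)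
    · exact glue_left (φ := ψ) (glue_left hx)
    · refine glue_le (t := (glue ψ (ψ' ∘ c) (glue a b r s) t).comap ψ') ?_ ?_ hy
      · intro x x' hx
        change glue _ _ _ _ (ψ' (b' x)) (ψ' (b' x'))
        rw [← hb, ← hb]
        exact glue_left (glue_right hx)
      · exact fun x x' hx => glue_right (ψ := ψ' ∘ c) hx

theorem countOn_congr {r : Setoid X} {s : Setoid Y} {P : X → Prop} {Q : Y → Prop} (φ : X → Y)
    (hP : ∀ x, P x → Q (φ x)) (hr : ∀ x x', P x → P x' → (r x x' ↔ s (φ x) (φ x')))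
    (hs : ∀ y, Q y → ∃ x, P x ∧ s (φ x) y) : countOn r P = countOn s Q := by
  refine Nat.card_eq_of_bijective
    (Quotient.map (fun x : {x // P x} => (⟨φ x.1, hP x.1 x.2⟩ : {y // Q y}))
      (fun x x' h => (hr x.1 x'.1 x.2 x'.2).1 h)) ⟨?_, ?_⟩
  · rintro ⟨x⟩ ⟨x'⟩ h
    have h' := Quotient.exact h
    exact Quotient.sound ((hr x.1 x'.1 x.2 x'.2).2 h')
  · rintro ⟨y⟩
    obtain ⟨x, hx, hxy⟩ := hs y.1 y.2
    exact ⟨Quotient.mk _ ⟨x, hx⟩, Quotient.sound hxy⟩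

theorem countOn_split [Finite X] (r : Setoid X) (P S : X → Prop)
    (hS : ∀ x x', r x x' → S x → S x') :
    countOn r P = countOn r (fun x => P x ∧ ¬ S x) + countOn r (fun x => P x ∧ S x) := by
  unfold countOn
  rw [← Nat.card_sum]
  symm
  refine Nat.card_eq_of_bijective
    (Sum.elim
      (Quotient.map (fun x : {x // P x ∧ ¬ S x} => (⟨x.1, x.2.1⟩ : {x // P x})) (fun _ _ h => h))
      (Quotient.map (fun x : {x // P x ∧ S x} => (⟨x.1, x.2.1⟩ : {x // P x})) (fun _ _ h => h)))
    ⟨?_, ?_⟩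
  · have ex : ∀ a b : {x // P x}, Quotient.mk (r.comap Subtype.val) a = Quotient.mk _ b →
        r a.1 b.1 := fun a b h => (Quotient.exact h : (r.comap Subtype.val) a b)
    rintro (q | q) (q' | q') h <;> obtain ⟨x⟩ := q <;> obtain ⟨y⟩ := q'
    · exact congrArg Sum.inl (Quotient.sound (ex ⟨x.1, x.2.1⟩ ⟨y.1, y.2.1⟩ h))
    · have h' := ex ⟨x.1, x.2.1⟩ ⟨y.1, y.2.1⟩ h
      exact absurd (hS _ _ (r.symm h') y.2.2) x.2.2
    · have h' := ex ⟨x.1, x.2.1⟩ ⟨y.1, y.2.1⟩ h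
      exact absurd (hS _ _ h' x.2.2) y.2.2
    · exact congrArg Sum.inr (Quotient.sound (ex ⟨x.1, x.2.1⟩ ⟨y.1, y.2.1⟩ h))
  · rintro ⟨x⟩
    by_cases hx : S x.1
    · exact ⟨Sum.inr (Quotient.mk _ ⟨x.1, x.2, hx⟩), rfl⟩
    · exact ⟨Sum.inl (Quotient.mk _ ⟨x.1, x.2, hx⟩), rfl⟩

theorem countOn_eq_zero {r : Setoid X} {P : X → Prop} (h : ∀ x, ¬ P x) : countOn r P = 0 := by
  have : IsEmpty (Quotient (r.comap (Subtype.val : {x // P x} → X))) :=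
    ⟨by rintro ⟨x⟩; exact h x.1 x.2⟩
  exact Nat.card_of_isEmpty

section Elim

variable {φ : X → Y} {ψ : Z → Y} {κ : V → Z} {ι : V → X} {χ : W → X}

theorem glue_trace (hφ : Function.Injective φ) (hψ : Function.Injective ψ)
    (hp : ∀ z x, ψ z = φ x → ∃ v, κ v = z ∧ ι v = x) (t : Setoid Z) (u : Setoid W)
    {y y' : Y} (h : glue ψ (φ ∘ χ) t u y y') (x : X)
    (hy : y = φ x ∨ ∃ z v, y = ψ z ∧ t z (κ v) ∧ ι v = x) :
    ∃ x', (y' = φ x' ∨ ∃ z v, y' = ψ z ∧ t z (κ v) ∧ ι v = x') ∧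
      glue ι χ (t.comap κ) u x x' := by
  let R : Y → X → Prop := fun y x => y = φ x ∨ ∃ z v, y = ψ z ∧ t z (κ v) ∧ ι v = x
  let s := glue ι χ (t.comap κ) u
  let T : Setoid Y :=
    { r := fun y y' => (∀ x, R y x → ∃ x', R y' x' ∧ s x x') ∧
        (∀ x, R y' x → ∃ x', R y x' ∧ s x x')
      iseqv :=
        ⟨fun y => ⟨fun x hx => ⟨x, hx, s.refl x⟩, fun x hx => ⟨x, hx, s.refl x⟩⟩,
         fun h => ⟨h.2, h.1⟩, fun h h' =>
          ⟨fun x hx => by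
            obtain ⟨x₁, h₁, e₁⟩ := h.1 x hx
            obtain ⟨x₂, h₂, e₂⟩ := h'.1 x₁ h₁
            exact ⟨x₂, h₂, s.trans e₁ e₂⟩,
           fun x hx => by
            obtain ⟨x₁, h₁, e₁⟩ := h'.2 x hx
            obtain ⟨x₂, h₂, e₂⟩ := h.2 x₁ h₁
            exact ⟨x₂, h₂, s.trans e₁ e₂⟩⟩⟩ }
  have key₁ : ∀ z z', t z z' → ∀ x, R (ψ z) x → ∃ x', R (ψ z') x' ∧ s x x' := by
    rintro z z' hz x (hx | ⟨z₁, v, hz₁, hv, rfl⟩)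
    · obtain ⟨v, rfl, rfl⟩ := hp _ _ hx
      exact ⟨ι v, Or.inr ⟨z', v, rfl, t.symm hz, rfl⟩, s.refl _⟩
    · obtain rfl := hψ hz₁
      exact ⟨ι v, Or.inr ⟨z', v, rfl, t.trans (t.symm hz) hv, rfl⟩, s.refl _⟩
  have key₂ : ∀ w w', u w w' → ∀ x, R (φ (χ w)) x → ∃ x', R (φ (χ w')) x' ∧ s x x' := by
    rintro w w' hw x hx
    have hsw : s (χ w) (χ w') := glue_right hw
    refine ⟨χ w', Or.inl rfl, s.trans ?_ hsw⟩
    rcases hx with hx | ⟨z, v, hz, hv, rfl⟩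
    · rw [hφ hx]
    · obtain ⟨v', rfl, hv'⟩ := hp _ _ hz.symm
      rw [← hv']
      exact s.symm (glue_left (φ := ι) (r := t.comap κ) hv)
  have : T y y' := glue_le (t := T) (fun z z' hz => ⟨key₁ z z' hz, key₁ z' z (t.symm hz)⟩)
    (fun w w' hw => ⟨key₂ w w' hw, key₂ w' w (u.symm hw)⟩) h
  exact this.1 x hy

theorem glue_elim (hφ : Function.Injective φ) (hψ : Function.Injective ψ)
    (hc : ∀ v, ψ (κ v) = φ (ι v))
    (hp : ∀ z x, ψ z = φ x → ∃ v, κ v = z ∧ ι v = x) (t : Setoid Z) (u : Setoid W)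
    (x x' : X) :
    glue ψ (φ ∘ χ) t u (φ x) (φ x') ↔ glue ι χ (t.comap κ) u x x' := by
  constructor
  · intro h
    obtain ⟨x'', h₁, h₂⟩ := glue_trace hφ hψ hp t u h x (Or.inl rfl)
    rcases h₁ with h₁ | ⟨z, v, hz, hv, rfl⟩
    · rwa [hφ h₁]
    · obtain ⟨v', rfl, rfl⟩ := hp _ _ hz.symm
      exact (glue ι χ (t.comap κ) u).trans h₂
        ((glue ι χ (t.comap κ) u).symm (glue_left (φ := ι) (r := t.comap κ) hv))
  · refine glue_le (t := (glue ψ (φ ∘ χ) t u).comap φ) (fun v v' hv => ?_) (fun w w' hw => ?_)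
    · change glue _ _ _ _ (φ (ι v)) (φ (ι v'))
      rw [← hc, ← hc]
      exact glue_left hv
    · exact glue_right (ψ := φ ∘ χ) hw

theorem glue_closed (hψ : Function.Injective ψ)
    (hp : ∀ z x, ψ z = φ x → ∃ v, κ v = z ∧ ι v = x) (t : Setoid Z) (u : Setoid W)
    {z : Z} (hz : ∀ v, ¬ t z (κ v)) {y : Y}
    (h : glue ψ (φ ∘ χ) t u (ψ z) y) : ∃ z', y = ψ z' ∧ t z z' := by
  let T : Setoid Y :=
    { r := fun y y' => (∃ z', y = ψ z' ∧ t z z') ↔ (∃ z', y' = ψ z' ∧ t z z')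
      iseqv := ⟨fun _ => Iff.rfl, Iff.symm, Iff.trans⟩ }
  have : T (ψ z) y := by
    refine glue_le (t := T) (fun z₁ z₂ h₁₂ => ?_) (fun w w' _ => ?_) h
    · constructor
      · rintro ⟨z', h', h''⟩
        obtain rfl := hψ h'
        exact ⟨z₂, rfl, t.trans h'' h₁₂⟩
      · rintro ⟨z', h', h''⟩
        obtain rfl := hψ h'
        exact ⟨z₁, rfl, t.trans h'' (t.symm h₁₂)⟩
    · constructor
      · rintro ⟨z', h', h''⟩
        obtain ⟨v, rfl, -⟩ := hp _ _ h'.symm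
        exact absurd h'' (hz v)
      · rintro ⟨z', h', h''⟩
        obtain ⟨v, rfl, -⟩ := hp _ _ h'.symm
        exact absurd h'' (hz v)
  exact this.1 ⟨z, rfl, t.refl z⟩

theorem countOn_elim [Finite Y] (hφ : Function.Injective φ) (hψ : Function.Injective ψ)
    (hc : ∀ v, ψ (κ v) = φ (ι v))
    (hp : ∀ z x, ψ z = φ x → ∃ v, κ v = z ∧ ι v = x) (t : Setoid Z) (u : Setoid W)
    (hcov : ∀ y, (∃ x, y = φ x) ∨ ∃ z, y = ψ z) (o : U → X) :
    countOn (glue ψ (φ ∘ χ) t u) (fun y => ∀ i, ¬ glue ψ (φ ∘ χ) t u y (φ (o i))) =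
      countOn t (fun z => ∀ v, ¬ t z (κ v)) +
      countOn (glue ι χ (t.comap κ) u) (fun x => ∀ i, ¬ glue ι χ (t.comap κ) u x (o i)) := by
  set J := glue ψ (φ ∘ χ) t u with hJ
  rw [countOn_split J _ (fun y => ∃ x, J y (φ x))
    (fun y y' h ⟨x, hx⟩ => ⟨x, J.trans (J.symm h) hx⟩)]
  congr 1
  · symm
    have hno : ∀ z, (∀ v, ¬ t z (κ v)) → ∀ x, ¬ J (ψ z) (φ x) := by
      intro z hz x hx
      obtain ⟨z', h₁, h₂⟩ := glue_closed hψ hp t u hz hx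
      obtain ⟨v, rfl, -⟩ := hp _ _ h₁.symm
      exact hz v h₂
    refine countOn_congr ψ (fun z hz => ⟨fun i => hno z hz _, fun ⟨x, hx⟩ => hno z hz x hx⟩)
      (fun z z' hz _ => ⟨fun h => glue_left h, fun h => ?_⟩) (fun y hy => ?_)
    · obtain ⟨z'', h₁, h₂⟩ := glue_closed hψ hp t u hz h
      rwa [hψ h₁]
    · rcases hcov y with ⟨x, rfl⟩ | ⟨z, rfl⟩
      · exact absurd ⟨x, J.refl _⟩ hy.2
      · refine ⟨z, fun v hv => hy.2 ⟨ι v, ?_⟩, J.refl _⟩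
        rw [← hc]
        exact glue_left hv
  · symm
    have he := glue_elim (χ := χ) hφ hψ hc hp t u
    refine countOn_congr φ (fun x hx => ⟨fun i hi => hx i ((he _ _).1 hi), x, J.refl _⟩)
      (fun x x' _ _ => (he x x').symm) (fun y hy => ?_)
    obtain ⟨h₁, x, hx⟩ := hy
    exact ⟨x, fun i hi => h₁ i (J.trans hx ((he _ _).2 hi)), J.symm hx⟩

end Elim

end Glue

section Stack

variable {A B C D : Type}

/-- A diagram with the points `A` on its bottom edge and `B` on its top edge is recorded by the
equivalence relation on `A ⊕ B` that tells which points are joined. Here a diagram `s` from `B` to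
`C` is stacked on top of a diagram `r` from `A` to `B`: points of `A ⊕ B ⊕ C` are equivalent when
they lie on the same connected component of the result. -/
def stack (r : Setoid (A ⊕ B)) (s : Setoid (B ⊕ C)) : Setoid (A ⊕ B ⊕ C) :=
  glue (Sum.map id Sum.inl) Sum.inr r s

/-- The points on the bottom and top edges of a stacked diagram. -/
def outer : A ⊕ C → A ⊕ B ⊕ C := Sum.map id Sum.inr

/-- The diagram from `A` to `C` given by stacking `s` on top of `r` and forgetting the middle
points (and hence the loops). -/
def stackOuter (r : Setoid (A ⊕ B)) (s : Setoid (B ⊕ C)) : Setoid (A ⊕ C) :=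
  (stack r s).comap outer

/-- The number of loops in the stacked diagram, that is, of connected components that contain no
point of the bottom edge and no point of the top edge. -/
noncomputable def loopCount (r : Setoid (A ⊕ B)) (s : Setoid (B ⊕ C)) : ℕ :=
  countOn (stack r s) fun x => ∀ v : A ⊕ C, ¬ stack r s x (outer v)

/-- The identity diagram: each bottom point is joined to the corresponding top point. -/
def idRel (A : Type) : Setoid (A ⊕ A) := Setoid.ker (Sum.elim id id)

section Assoc

variable (r : Setoid (A ⊕ B)) (s : Setoid (B ⊕ C)) (t : Setoid (C ⊕ D))

theorem triple_eq :
    glue (Sum.map id (Sum.map id Sum.inl) : A ⊕ B ⊕ C → A ⊕ B ⊕ C ⊕ D)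
      ((Sum.map id Sum.inr : A ⊕ C ⊕ D → A ⊕ B ⊕ C ⊕ D) ∘ Sum.inr) (stack r s) t =
    glue (Sum.inr : B ⊕ C ⊕ D → A ⊕ B ⊕ C ⊕ D)
      ((Sum.map id (Sum.map id Sum.inr) : A ⊕ B ⊕ D → A ⊕ B ⊕ C ⊕ D) ∘ Sum.map id Sum.inl)
      (stack s t) r := by
  have h := glue_assoc (Sum.map id Sum.inl : A ⊕ B → A ⊕ B ⊕ C) (Sum.inr : B ⊕ C → A ⊕ B ⊕ C)
    (Sum.map id (Sum.map id Sum.inl) : A ⊕ B ⊕ C → A ⊕ B ⊕ C ⊕ D)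
    (Sum.map id Sum.inl : B ⊕ C → B ⊕ C ⊕ D) (Sum.inr : C ⊕ D → B ⊕ C ⊕ D) Sum.inr rfl r s t
  refine Eq.trans h (Eq.trans (glue_comm _ _ _ _) ?_)
  congr 1
  funext x
  rcases x with x | x <;> rfl

theorem pullback₁ (z : A ⊕ B ⊕ C) (x : A ⊕ C ⊕ D)
    (h : (Sum.map id (Sum.map id Sum.inl) z : A ⊕ B ⊕ C ⊕ D) = Sum.map id Sum.inr x) :
    ∃ v : A ⊕ C, outer v = z ∧ (Sum.map id Sum.inl v : A ⊕ C ⊕ D) = x := by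
  rcases z with a | b | c <;> rcases x with a' | c' | d' <;> simp [Sum.map] at h
  · exact ⟨Sum.inl a, rfl, by rw [← h]; rfl⟩
  · exact ⟨Sum.inr c, rfl, by rw [← h]; rfl⟩

theorem pullback₂ (z : B ⊕ C ⊕ D) (x : A ⊕ B ⊕ D)
    (h : (Sum.inr z : A ⊕ B ⊕ C ⊕ D) = Sum.map id (Sum.map id Sum.inr) x) :
    ∃ v : B ⊕ D, outer v = z ∧ (Sum.inr v : A ⊕ B ⊕ D) = x := by
  rcases z with a | b | c <;> rcases x with a' | c' | d' <;> simp [Sum.map] at h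
  · exact ⟨Sum.inl a, rfl, by rw [← h]⟩
  · exact ⟨Sum.inr c, rfl, by rw [← h]⟩

theorem inj₁ : Function.Injective (Sum.map id Sum.inr : A ⊕ C ⊕ D → A ⊕ B ⊕ C ⊕ D) :=
  Function.injective_id.sumMap Sum.inr_injective

theorem inj₂ : Function.Injective
    (Sum.map id (Sum.map id Sum.inl) : A ⊕ B ⊕ C → A ⊕ B ⊕ C ⊕ D) :=
  Function.injective_id.sumMap (Function.injective_id.sumMap Sum.inl_injective)

theorem inj₃ : Function.Injective
    (Sum.map id (Sum.map id Sum.inr) : A ⊕ B ⊕ D → A ⊕ B ⊕ C ⊕ D) :=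
  Function.injective_id.sumMap (Function.injective_id.sumMap Sum.inr_injective)

theorem stack_left (x y : A ⊕ C ⊕ D) :
    glue (Sum.map id (Sum.map id Sum.inl) : A ⊕ B ⊕ C → A ⊕ B ⊕ C ⊕ D)
      ((Sum.map id Sum.inr : A ⊕ C ⊕ D → A ⊕ B ⊕ C ⊕ D) ∘ Sum.inr) (stack r s) t
      (Sum.map id Sum.inr x) (Sum.map id Sum.inr y) ↔ stack (stackOuter r s) t x y :=
  glue_elim (κ := outer) (ι := Sum.map id Sum.inl) inj₁ inj₂
    (by rintro (v | v) <;> rfl) pullback₁ (stack r s) t x y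

theorem stack_right (x y : A ⊕ B ⊕ D) :
    glue (Sum.inr : B ⊕ C ⊕ D → A ⊕ B ⊕ C ⊕ D)
      ((Sum.map id (Sum.map id Sum.inr) : A ⊕ B ⊕ D → A ⊕ B ⊕ C ⊕ D) ∘ Sum.map id Sum.inl)
      (stack s t) r (Sum.map id (Sum.map id Sum.inr) x) (Sum.map id (Sum.map id Sum.inr) y) ↔
    stack r (stackOuter s t) x y := by
  rw [glue_elim (κ := outer) (ι := Sum.inr) inj₃ Sum.inr_injective
    (by rintro (v | v) <;> rfl) pullback₂ (stack s t) r x y, glue_comm]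
  rfl

theorem stackOuter_assoc :
    stackOuter (stackOuter r s) t = stackOuter r (stackOuter s t) := by
  ext x y
  have e : ∀ x : A ⊕ D, (Sum.map id Sum.inr (outer x : A ⊕ C ⊕ D) : A ⊕ B ⊕ C ⊕ D) =
      Sum.map id (Sum.map id Sum.inr) (outer x : A ⊕ B ⊕ D) := by rintro (x | x) <;> rfl
  have h₁ := stack_left r s t (outer x) (outer y)
  have h₂ := stack_right r s t (outer x) (outer y)
  rw [triple_eq, e, e] at h₁
  exact h₁.symm.trans h₂

theorem loopCount_assoc [Finite A] [Finite B] [Finite C] [Finite D] :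
    loopCount r s + loopCount (stackOuter r s) t =
      loopCount s t + loopCount r (stackOuter s t) := by
  have e : ∀ x : A ⊕ D, (Sum.map id Sum.inr (outer x : A ⊕ C ⊕ D) : A ⊕ B ⊕ C ⊕ D) =
      Sum.map id (Sum.map id Sum.inr) (outer x : A ⊕ B ⊕ D) := by rintro (x | x) <;> rfl
  have h₁ := countOn_elim (κ := outer) (ι := (Sum.map id Sum.inl : A ⊕ C → A ⊕ C ⊕ D))
    (χ := (Sum.inr : C ⊕ D → A ⊕ C ⊕ D)) inj₁ inj₂
    (by rintro (v | v) <;> rfl) pullback₁ (stack r s) t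
    (by
      rintro (a | b | c | d)
      · exact Or.inl ⟨Sum.inl a, rfl⟩
      · exact Or.inr ⟨Sum.inr (Sum.inl b), rfl⟩
      · exact Or.inl ⟨Sum.inr (Sum.inl c), rfl⟩
      · exact Or.inl ⟨Sum.inr (Sum.inr d), rfl⟩) (outer : A ⊕ D → A ⊕ C ⊕ D)
  have h₂ := countOn_elim (κ := outer) (ι := (Sum.inr : B ⊕ D → A ⊕ B ⊕ D))
    (χ := (Sum.map id Sum.inl : A ⊕ B → A ⊕ B ⊕ D)) inj₃ Sum.inr_injective
    (by rintro (v | v) <;> rfl) pullback₂ (stack s t) r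
    (by
      rintro (a | z)
      · exact Or.inl ⟨Sum.inl a, rfl⟩
      · exact Or.inr ⟨z, rfl⟩) (outer : A ⊕ D → A ⊕ B ⊕ D)
  rw [triple_eq] at h₁
  simp only [e] at h₁
  rw [h₁, glue_comm Sum.inr] at h₂
  exact h₂

end Assoc

theorem stack_idRel (r : Setoid (A ⊕ B)) (x y : A ⊕ A ⊕ B) :
    stack (idRel A) r x y ↔ r (Sum.elim Sum.inl id x) (Sum.elim Sum.inl id y) := by
  have hl : ∀ x : A ⊕ A ⊕ B, stack (idRel A) r x (Sum.inr (Sum.elim Sum.inl id x)) := by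
    rintro (a | x)
    · exact glue_left (φ := Sum.map id Sum.inl) (a := Sum.inl a) (b := Sum.inr a)
        (show idRel A _ _ from rfl)
    · exact Setoid.refl' _ _
  constructor
  · refine glue_le (t := r.comap (Sum.elim Sum.inl id)) (fun a b hab => ?_) (fun a b hab => ?_)
    on_goal 2 => exact hab
    have : Sum.elim id id a = Sum.elim id id b := hab
    rcases a with a | a <;> rcases b with b | b <;> obtain rfl : a = b := this <;>
      exact Setoid.refl' _ _
  · intro h
    exact Setoid.trans' _ (hl x) (Setoid.trans' _ (glue_right h) (Setoid.symm' _ (hl y)))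

theorem stack_comp_idRel (r : Setoid (A ⊕ B)) (x y : A ⊕ B ⊕ B) :
    stack r (idRel B) x y ↔
      r (Sum.map id (Sum.elim id id) x) (Sum.map id (Sum.elim id id) y) := by
  have hl : ∀ x : A ⊕ B ⊕ B, stack r (idRel B) x
      (Sum.map id Sum.inl (Sum.map id (Sum.elim id id) x)) := by
    rintro (a | b | b)
    · exact Setoid.refl' _ _
    · exact Setoid.refl' _ _
    · exact glue_right (ψ := Sum.inr) (a := Sum.inr b) (b := Sum.inl b)
        (show idRel B _ _ from rfl)
  constructor
  · refine glue_le (t := r.comap (Sum.map id (Sum.elim id id))) (fun a b hab => ?_)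
      (fun a b hab => ?_)
    · rcases a with a | a <;> rcases b with b | b <;> exact hab
    · have : Sum.elim id id a = Sum.elim id id b := hab
      rcases a with a | a <;> rcases b with b | b <;> obtain rfl : a = b := this <;>
        exact Setoid.refl' _ _
  · intro h
    exact Setoid.trans' _ (hl x) (Setoid.trans' _ (glue_left h) (Setoid.symm' _ (hl y)))

theorem stackOuter_idRel (r : Setoid (A ⊕ B)) : stackOuter (idRel A) r = r := by
  ext x y
  refine (stack_idRel r (outer x) (outer y)).trans ?_
  rcases x with x | x <;> rcases y with y | y <;> rfl

theorem stackOuter_comp_idRel (r : Setoid (A ⊕ B)) : stackOuter r (idRel B) = r := by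
  ext x y
  refine (stack_comp_idRel r (outer x) (outer y)).trans ?_
  rcases x with x | x <;> rcases y with y | y <;> rfl

theorem loopCount_idRel (r : Setoid (A ⊕ B)) : loopCount (idRel A) r = 0 := by
  refine countOn_eq_zero fun x hx => ?_
  rcases x with a | a | b
  · exact hx (Sum.inl a) (Setoid.refl' _ _)
  · exact hx (Sum.inl a) ((stack_idRel r _ _).2 (Setoid.refl' _ _))
  · exact hx (Sum.inr b) (Setoid.refl' _ _)

theorem loopCount_comp_idRel (r : Setoid (A ⊕ B)) : loopCount r (idRel B) = 0 := by
  refine countOn_eq_zero fun x hx => ?_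
  rcases x with a | a | b
  · exact hx (Sum.inl a) (Setoid.refl' _ _)
  · exact hx (Sum.inr a) ((stack_comp_idRel r _ _).2 (Setoid.refl' _ _))
  · exact hx (Sum.inr b) (Setoid.refl' _ _)

end Stack

section Planar

/-- Every class of `r` has exactly two elements. -/
def IsPairing {X : Type} (r : Setoid X) : Prop := ∀ x, ∃! y, y ≠ x ∧ r x y

/-- With the points placed on a line by `pos`, no class of `r` crosses another one. -/
def IsNoncrossing {X : Type} (pos : X → ℤ) (r : Setoid X) : Prop :=
  ∀ a b c d, pos a < pos b → pos b < pos c → pos c < pos d → r a c → r b d → False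

/-- The relation on the points of `S` is a noncrossing pairing. -/
structure PlanarOn {Y : Type} (pos : Y → ℤ) (r : Setoid Y) (S : Set Y) : Prop where
  ex : ∀ x ∈ S, ∃ y ∈ S, y ≠ x ∧ r x y
  uniq : ∀ x ∈ S, ∀ y ∈ S, ∀ z ∈ S, r x y → r x z → y ≠ x → z ≠ x → y = z
  nc : ∀ a ∈ S, ∀ b ∈ S, ∀ c ∈ S, ∀ d ∈ S, pos a < pos b → pos b < pos c → pos c < pos d →
    r a c → r b d → False

theorem PlanarOn.step {Y : Type} {pos : Y → ℤ} {r r' : Setoid Y} {S : Set Y}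
    (h : PlanarOn pos r S) (hpos : Function.Injective pos) {p q : Y} (hp : p ∈ S) (hq : q ∈ S)
    (hpq : pos p < pos q) (hadj : ∀ x ∈ S, ¬ (pos p < pos x ∧ pos x < pos q))
    (hr : ∀ a b, r' a b ↔ r a b ∨ (r a p ∧ r q b) ∨ (r a q ∧ r p b)) :
    PlanarOn pos r' (S \ {p, q}) := by
  have hsym : ∀ {a b}, r a b → r b a := fun h => r.symm h
  have htr : ∀ {a b c}, r a b → r b c → r a c := fun h h' => r.trans h h'
  have hne : p ≠ q := by rintro rfl; exact lt_irrefl _ hpq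
  have three : ∀ a ∈ S, ∀ b ∈ S, ∀ c ∈ S, r a b → r a c → a ≠ b → a ≠ c → b ≠ c → False :=
    fun a ha b hb c hc hab hac h₁ h₂ h₃ => h₃ (h.uniq a ha b hb c hc hab hac h₁.symm h₂.symm)
  have out : ∀ {x}, x ∈ S → x ≠ p → x ≠ q → pos x < pos p ∨ pos q < pos x := by
    intro x hx h₁ h₂
    have := hadj x hx
    have h₃ : pos x ≠ pos p := fun e => h₁ (hpos e)
    have h₄ : pos x ≠ pos q := fun e => h₂ (hpos e)
    grind
  constructor
  · rintro x ⟨hx, hx'⟩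
    simp only [Set.mem_insert_iff, Set.mem_singleton_iff, not_or] at hx'
    obtain ⟨y, hy, hyx, hxy⟩ := h.ex x hx
    by_cases hyp : y = p
    · subst hyp
      obtain ⟨w, hw, hwq, hqw⟩ := h.ex q hq
      refine ⟨w, ⟨hw, ?_⟩, ?_, (hr _ _).2 (Or.inr (Or.inl ⟨hxy, hqw⟩))⟩
      · simp only [Set.mem_insert_iff, Set.mem_singleton_iff, not_or]
        refine ⟨?_, hwq⟩
        rintro rfl
        exact three w hw x hx q hq (hsym hxy) (hsym hqw) hyx hne hx'.2
      · rintro rfl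
        exact three w hx y hp q hq hxy (hsym hqw) hx'.1 hx'.2 hne
    by_cases hyq : y = q
    · subst hyq
      obtain ⟨w, hw, hwp, hpw⟩ := h.ex p hp
      refine ⟨w, ⟨hw, ?_⟩, ?_, (hr _ _).2 (Or.inr (Or.inr ⟨hxy, hpw⟩))⟩
      · simp only [Set.mem_insert_iff, Set.mem_singleton_iff, not_or]
        refine ⟨hwp, ?_⟩
        rintro rfl
        exact three w hw x hx p hp (hsym hxy) (hsym hpw) hyx hne.symm hx'.1
      · rintro rfl
        exact three w hx p hp y hq (hsym hpw) hxy hx'.1 hx'.2 hne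
    · refine ⟨y, ⟨hy, ?_⟩, hyx, (hr _ _).2 (Or.inl hxy)⟩
      simp only [Set.mem_insert_iff, Set.mem_singleton_iff, not_or]
      exact ⟨hyp, hyq⟩
  · rintro x ⟨hx, hx'⟩ y ⟨hy, hy'⟩ z ⟨hz, hz'⟩ hxy hxz hyx hzx
    simp only [Set.mem_insert_iff, Set.mem_singleton_iff, not_or] at hx' hy' hz'
    rw [hr] at hxy hxz
    by_contra hyz
    rcases hxy with hxy | ⟨h₁, h₂⟩ | ⟨h₁, h₂⟩ <;> rcases hxz with hxz | ⟨h₃, h₄⟩ | ⟨h₃, h₄⟩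
    · exact three x hx y hy z hz hxy hxz hyx.symm hzx.symm hyz
    · exact three x hx y hy p hp hxy h₃ hyx.symm hx'.1 hy'.1
    · exact three x hx y hy q hq hxy h₃ hyx.symm hx'.2 hy'.2
    · exact three x hx z hz p hp hxz h₁ hzx.symm hx'.1 hz'.1
    · exact three q hq y hy z hz h₂ h₄ (Ne.symm hy'.2) (Ne.symm hz'.2) hyz
    · exact three x hx p hp q hq h₁ h₃ hx'.1 hx'.2 hne
    · exact three x hx z hz q hq hxz h₁ hzx.symm hx'.2 hz'.2
    · exact three x hx p hp q hq h₃ h₁ hx'.1 hx'.2 hne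
    · exact three p hp y hy z hz h₂ h₄ (Ne.symm hy'.1) (Ne.symm hz'.1) hyz
  · rintro a ⟨ha, ha'⟩ b ⟨hb, hb'⟩ c ⟨hc, hc'⟩ d ⟨hd, hd'⟩ hab hbc hcd hac hbd
    simp only [Set.mem_insert_iff, Set.mem_singleton_iff, not_or] at ha' hb' hc' hd'
    have nab : a ≠ b := by rintro rfl; exact lt_irrefl _ hab
    have nad : a ≠ d := by rintro rfl; exact lt_irrefl _ (hab.trans (hbc.trans hcd))
    have nbc : b ≠ c := by rintro rfl; exact lt_irrefl _ hbc
    have oa := out ha ha'.1 ha'.2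
    have ob := out hb hb'.1 hb'.2
    have oc := out hc hc'.1 hc'.2
    have od := out hd hd'.1 hd'.2
    -- an arc `u v` and two further points `w`, `x`, on different sides of it, that are linked
    -- to the two adjacent points
    have side : ∀ u ∈ S, ∀ v ∈ S, ∀ w ∈ S, ∀ x ∈ S, ∀ p' ∈ S, ∀ q' ∈ S,
        pos u < pos w → pos w < pos v → r u v → (pos x < pos u ∨ pos v < pos x) →
        r w p' → r x q' → ((pos p' < pos u ∧ pos q' < pos u) ∨
          (pos u < pos p' ∧ pos p' < pos v ∧ pos u < pos q' ∧ pos q' < pos v) ∨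
          (pos v < pos p' ∧ pos v < pos q')) → False := by
      intro u hu v hv w hw x hx p' hp' q' hq' h₁ h₂ huv h₃ hwp hxq h₄
      rcases h₄ with h₄ | h₄ | h₄
      · exact h.nc p' hp' u hu w hw v hv h₄.1 h₁ h₂ (hsym hwp) huv
      · rcases h₃ with h₃ | h₃
        · exact h.nc x hx u hu q' hq' v hv h₃ h₄.2.2.1 h₄.2.2.2 hxq huv
        · exact h.nc u hu q' hq' v hv x hx h₄.2.2.1 h₄.2.2.2 h₃ huv (hsym hxq)
      · exact h.nc u hu w hw v hv p' hp' h₁ h₂ h₄.1 huv hwp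
    rw [hr] at hac hbd
    rcases hac with hac | ⟨h₁, h₂⟩ | ⟨h₁, h₂⟩ <;> rcases hbd with hbd | ⟨h₃, h₄⟩ | ⟨h₃, h₄⟩
    · exact h.nc a ha b hb c hc d hd hab hbc hcd hac hbd
    · exact side a ha c hc b hb d hd p hp q hq hab hbc hac (Or.inr hcd) h₃ (hsym h₄)
        (by grind)
    · exact side a ha c hc b hb d hd q hq p hp hab hbc hac (Or.inr hcd) h₃ (hsym h₄)
        (by grind)
    · exact side b hb d hd c hc a ha q hq p hp hbc hcd hbd (Or.inl hab) (hsym h₂) h₁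
        (by grind)
    · exact three a ha b hb p hp (htr h₁ (hsym h₃)) h₁ nab ha'.1 hb'.1
    · exact three a ha d hd p hp (htr h₁ h₄) h₁ nad ha'.1 hd'.1
    · exact side b hb d hd c hc a ha p hp q hq hbc hcd hbd (Or.inl hab) (hsym h₂) h₁
        (by grind)
    · exact three a ha d hd q hq (htr h₁ h₄) h₁ nad ha'.2 hd'.2
    · exact three a ha b hb q hq (htr h₁ (hsym h₃)) h₁ nab ha'.2 hb'.2

/-- The disjoint union of two equivalence relations. -/
def sumRel {X Y : Type} (r : Setoid X) (s : Setoid Y) : Setoid (X ⊕ Y) where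
  r := Sum.LiftRel r s
  iseqv :=
    { refl := by
        rintro (x | y)
        · exact Sum.LiftRel.inl (r.refl x)
        · exact Sum.LiftRel.inr (s.refl y)
      symm := by
        rintro _ _ (h | h)
        · exact Sum.LiftRel.inl (r.symm h)
        · exact Sum.LiftRel.inr (s.symm h)
      trans := by
        rintro _ _ _ (h | h) (h' | h')
        · exact Sum.LiftRel.inl (r.trans h h')
        · exact Sum.LiftRel.inr (s.trans h h') }

/-- The equivalence relation obtained from `r` by merging the classes of `p` and `q`. -/
def mergePair {Y : Type} (r : Setoid Y) (p q : Y) : Setoid Y where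
  r a b := r a b ∨ (r a p ∧ r q b) ∨ (r a q ∧ r p b)
  iseqv :=
    { refl := fun x => Or.inl (r.refl x)
      symm := by
        rintro a b (h | ⟨h, h'⟩ | ⟨h, h'⟩)
        · exact Or.inl (r.symm h)
        · exact Or.inr (Or.inr ⟨r.symm h', r.symm h⟩)
        · exact Or.inr (Or.inl ⟨r.symm h', r.symm h⟩)
      trans := by
        rintro a b c (h | ⟨h, h'⟩ | ⟨h, h'⟩) (k | ⟨k, k'⟩ | ⟨k, k'⟩)
        · exact Or.inl (r.trans h k)
        · exact Or.inr (Or.inl ⟨r.trans h k, k'⟩)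
        · exact Or.inr (Or.inr ⟨r.trans h k, k'⟩)
        · exact Or.inr (Or.inl ⟨h, r.trans h' k⟩)
        · exact Or.inr (Or.inl ⟨h, k'⟩)
        · exact Or.inl (r.trans h k')
        · exact Or.inr (Or.inr ⟨h, r.trans h' k⟩)
        · exact Or.inl (r.trans h k')
        · exact Or.inr (Or.inr ⟨h, k'⟩) }

/-- The points on the boundary of the square in their cyclic order: the top edge from right to
left, followed by the bottom edge from left to right. -/
def circlePos {m n : ℕ} : Fin m ⊕ Fin n → ℤ
  | Sum.inl i => (i : ℤ)
  | Sum.inr j => -(j : ℤ) - 1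

theorem circlePos_injective {m n : ℕ} :
    Function.Injective (circlePos : Fin m ⊕ Fin n → ℤ) := by
  rintro (i | i) (j | j) h <;> simp only [circlePos] at h
  · exact congrArg Sum.inl (Fin.ext (by omega))
  · omega
  · omega
  · exact congrArg Sum.inr (Fin.ext (by omega))

section StackPlanar

variable {m n k : ℕ}

def stackPos : (Fin m ⊕ Fin n) ⊕ (Fin n ⊕ Fin k) → ℤ
  | Sum.inl x => 2 * (n : ℤ) + circlePos x
  | Sum.inr y => circlePos y

theorem stackPos_injective :
    Function.Injective (stackPos : (Fin m ⊕ Fin n) ⊕ (Fin n ⊕ Fin k) → ℤ) := by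
  have hs : ∀ (x : Fin m ⊕ Fin n) (y : Fin n ⊕ Fin k),
      2 * (n : ℤ) + circlePos x ≠ circlePos y := by
    rintro (i | i) (j | j) <;> simp only [circlePos] <;> omega
  rintro (x | x) (y | y) h <;> simp only [stackPos] at h
  · exact congrArg Sum.inl (circlePos_injective (by omega))
  · exact absurd h (hs x y)
  · exact absurd h.symm (hs y x)
  · exact congrArg Sum.inr (circlePos_injective h)

/-- The points not yet glued when the `t` rightmost middle points are glued. -/
def live (t : ℕ) : (Fin m ⊕ Fin n) ⊕ (Fin n ⊕ Fin k) → Prop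
  | Sum.inl (Sum.inl _) => True
  | Sum.inl (Sum.inr j) => (j : ℕ) + t < n
  | Sum.inr (Sum.inl j) => (j : ℕ) + t < n
  | Sum.inr (Sum.inr _) => True

def unfoldPt : (Fin m ⊕ Fin n) ⊕ (Fin n ⊕ Fin k) → Fin m ⊕ Fin n ⊕ Fin k :=
  Sum.elim (Sum.map id Sum.inl) Sum.inr

theorem exists_planar_stage {r : Setoid (Fin m ⊕ Fin n)} {s : Setoid (Fin n ⊕ Fin k)}
    (hr : IsPairing r) (hr' : IsNoncrossing circlePos r)
    (hs : IsPairing s) (hs' : IsNoncrossing circlePos s) (t : ℕ) (ht : t ≤ n) :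
    ∃ R : Setoid ((Fin m ⊕ Fin n) ⊕ (Fin n ⊕ Fin k)),
      PlanarOn stackPos R {x | live t x} ∧
      (∀ x y, R x y → stack r s (unfoldPt x) (unfoldPt y)) ∧
      (∀ x y, sumRel r s x y → R x y) ∧
      ∀ j : Fin n, n ≤ (j : ℕ) + t → R (Sum.inl (Sum.inr j)) (Sum.inr (Sum.inl j)) := by
  induction t with
  | zero =>
    refine ⟨sumRel r s, ⟨?_, ?_, ?_⟩, ?_, fun _ _ h => h, fun j hj => by omega⟩
    · rintro (x | x) -
      · obtain ⟨y, ⟨h₁, h₂⟩, -⟩ := hr x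
        refine ⟨Sum.inl y, ?_, fun h => h₁ (Sum.inl_injective h), Sum.LiftRel.inl h₂⟩
        rcases y with y | y <;> simp [live]
      · obtain ⟨y, ⟨h₁, h₂⟩, -⟩ := hs x
        refine ⟨Sum.inr y, ?_, fun h => h₁ (Sum.inr_injective h), Sum.LiftRel.inr h₂⟩
        rcases y with y | y <;> simp [live]
    · rintro x - y - z - (h | h) (h' | h') hy hz
      · exact congrArg Sum.inl ((hr _).unique ⟨fun e => hy (congrArg _ e), h⟩
          ⟨fun e => hz (congrArg _ e), h'⟩)
      · exact congrArg Sum.inr ((hs _).unique ⟨fun e => hy (congrArg _ e), h⟩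
          ⟨fun e => hz (congrArg _ e), h'⟩)
    · have hlr : ∀ (x : Fin m ⊕ Fin n) (y : Fin n ⊕ Fin k),
          (stackPos (Sum.inr y : (Fin m ⊕ Fin n) ⊕ (Fin n ⊕ Fin k))) <
            stackPos (Sum.inl x : (Fin m ⊕ Fin n) ⊕ (Fin n ⊕ Fin k)) := by
        rintro (i | i) (j | j) <;> simp only [stackPos, circlePos] <;> omega
      rintro _ - _ - _ - _ - hab hbc hcd (@⟨a, c, hac⟩ | @⟨a, c, hac⟩)
        (@⟨b, d, hbd⟩ | @⟨b, d, hbd⟩)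
      · refine hr' a b c d ?_ ?_ ?_ hac hbd <;> simp only [stackPos] at hab hbc hcd <;> omega
      · exact lt_asymm hab (hlr a b)
      · exact lt_asymm hbc (hlr b c)
      · exact hs' a b c d hab hbc hcd hac hbd
    · rintro _ _ (h | h)
      · exact glue_left h
      · exact glue_right h
  | succ t ih =>
    obtain ⟨R, h₁, h₂, h₃, h₄⟩ := ih (by omega)
    let j : Fin n := ⟨n - 1 - t, by omega⟩
    have hj : (j : ℕ) = n - 1 - t := rfl
    let p : (Fin m ⊕ Fin n) ⊕ (Fin n ⊕ Fin k) := Sum.inr (Sum.inl j)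
    let q : (Fin m ⊕ Fin n) ⊕ (Fin n ⊕ Fin k) := Sum.inl (Sum.inr j)
    have hset : {x | live (t + 1) x} =
        ({x | live t x} \ {p, q} : Set ((Fin m ⊕ Fin n) ⊕ (Fin n ⊕ Fin k))) := by
      ext x
      rcases x with (x | x) | (x | x) <;>
        simp only [live, p, q, Set.mem_ofPred_eq, Set.mem_sdiff, Set.mem_insert_iff,
          Set.mem_singleton_iff, Sum.inl.injEq, Sum.inr.injEq, reduceCtorEq, or_false, false_or,
          Fin.ext_iff, hj, not_false_iff, and_true] <;> omega
    have hpq : stack r s (unfoldPt p) (unfoldPt q) := Setoid.refl' _ _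
    refine ⟨mergePair R p q, ?_, ?_, fun x y h => Or.inl (h₃ x y h), ?_⟩
    · rw [hset]
      refine h₁.step stackPos_injective ?_ ?_ ?_ ?_ (fun a b => Iff.rfl)
      · simp only [live, p, Set.mem_ofPred_eq, hj]; omega
      · simp only [live, q, Set.mem_ofPred_eq, hj]; omega
      · simp only [stackPos, p, q, circlePos, hj]; omega
      · rintro ((x | x) | (x | x)) hx <;>
          simp only [live, Set.mem_ofPred_eq, stackPos, p, q, circlePos, hj] at hx ⊢ <;> omega
    · rintro x y (h | ⟨h, h'⟩ | ⟨h, h'⟩)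
      · exact h₂ _ _ h
      · exact Setoid.trans' _ (h₂ _ _ h) (Setoid.trans' _ hpq (h₂ _ _ h'))
      · exact Setoid.trans' _ (h₂ _ _ h) (Setoid.trans' _ (Setoid.symm' _ hpq) (h₂ _ _ h'))
    · intro i hi
      by_cases hij : n ≤ (i : ℕ) + t
      · exact Or.inl (h₄ i hij)
      · obtain rfl : i = j := Fin.ext (by omega)
        exact Or.inr (Or.inr ⟨R.refl _, R.refl _⟩)

theorem stackOuter_planar {r : Setoid (Fin m ⊕ Fin n)} {s : Setoid (Fin n ⊕ Fin k)}
    (hr : IsPairing r) (hr' : IsNoncrossing circlePos r)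
    (hs : IsPairing s) (hs' : IsNoncrossing circlePos s) :
    IsPairing (stackOuter r s) ∧ IsNoncrossing circlePos (stackOuter r s) := by
  obtain ⟨R, h₁, h₂, h₃, h₄⟩ := exists_planar_stage hr hr' hs hs' n le_rfl
  have lift : ∀ a b, unfoldPt a = unfoldPt b → R a b := by
    rintro ((a | a) | (a | a)) ((b | b) | (b | b)) h <;>
      simp [unfoldPt] at h <;> subst h
    · exact R.refl _
    · exact R.refl _
    · exact h₄ _ (by omega)
    · exact R.symm (h₄ _ (by omega))
    · exact R.refl _
    · exact R.refl _
  let sec : Fin m ⊕ Fin n ⊕ Fin k → (Fin m ⊕ Fin n) ⊕ (Fin n ⊕ Fin k) :=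
    Sum.elim (fun i => Sum.inl (Sum.inl i)) Sum.inr
  have hsec : ∀ x, R (sec (unfoldPt x)) x := by
    intro x
    apply lift
    rcases x with (x | x) | x <;> rfl
  have key : ∀ x y, stack r s x y → R (sec x) (sec y) := by
    intro x y
    refine glue_le (t := R.comap sec) (fun a b hab => ?_) (fun a b hab => ?_)
    · exact R.trans (hsec (Sum.inl a)) (R.trans (h₃ _ _ (Sum.LiftRel.inl hab))
        (R.symm (hsec (Sum.inl b))))
    · exact h₃ _ _ (Sum.LiftRel.inr hab)
  let e : Fin m ⊕ Fin k → (Fin m ⊕ Fin n) ⊕ (Fin n ⊕ Fin k) := Sum.map Sum.inl Sum.inr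
  have he : ∀ x y, stackOuter r s x y ↔ R (e x) (e y) := by
    intro x y
    constructor
    · intro h
      have := key _ _ h
      rcases x with x | x <;> rcases y with y | y <;> exact this
    · intro h
      have := h₂ _ _ h
      rcases x with x | x <;> rcases y with y | y <;> exact this
  have heinj : Function.Injective e := Sum.inl_injective.sumMap Sum.inr_injective
  have hlive : ∀ x, live n (e x) := by rintro (x | x) <;> trivial
  have hmono : ∀ x y, circlePos x < circlePos y → stackPos (e x) < stackPos (e y) := by
    rintro (x | x) (y | y) h <;>
      simp only [e, Sum.map_inl, Sum.map_inr, stackPos, circlePos] at h ⊢ <;> omega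
  constructor
  · intro x
    obtain ⟨y, hy, hyx, hxy⟩ := h₁.ex (e x) (hlive x)
    obtain ⟨y, rfl⟩ : ∃ y', e y' = y := by
      rcases y with (y | y) | (y | y)
      · exact ⟨Sum.inl y, rfl⟩
      · simp [live] at hy
      · simp [live] at hy
      · exact ⟨Sum.inr y, rfl⟩
    refine ⟨y, ⟨fun h => hyx (congrArg e h), (he _ _).2 hxy⟩, ?_⟩
    rintro z ⟨hz, hxz⟩
    exact heinj (h₁.uniq _ (hlive x) _ (hlive z) _ (hlive y) ((he _ _).1 hxz) hxy
      (fun h => hz (heinj h)) hyx)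
  · intro a b c d hab hbc hcd hac hbd
    exact h₁.nc _ (hlive a) _ (hlive b) _ (hlive c) _ (hlive d) (hmono _ _ hab) (hmono _ _ hbc)
      (hmono _ _ hcd) ((he _ _).1 hac) ((he _ _).1 hbd)

end StackPlanar

theorem idRel_planar (n : ℕ) :
    IsPairing (idRel (Fin n)) ∧ IsNoncrossing circlePos (idRel (Fin n)) := by
  constructor
  · rintro (i | i)
    · refine ⟨Sum.inr i, ⟨by simp, rfl⟩, ?_⟩
      rintro (j | j) ⟨h, h'⟩ <;> obtain rfl : i = j := h'
      · exact absurd rfl h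
      · rfl
    · refine ⟨Sum.inl i, ⟨by simp, rfl⟩, ?_⟩
      rintro (j | j) ⟨h, h'⟩ <;> obtain rfl : i = j := h'
      · rfl
      · exact absurd rfl h
  · intro a b c d hab hbc hcd hac hbd
    rcases a with a | a <;> rcases c with c | c <;> obtain rfl : a = c := hac <;>
      rcases b with b | b <;> rcases d with d | d <;> obtain rfl : b = d := hbd <;>
        simp only [circlePos] at hab hbc hcd <;> omega

end Planar

section Juxtapose

variable {A A' A₂ B B' B₂ C C' C₂ : Type}

/-- Juxtaposition of two diagrams, after identifying the points on each edge with the points of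
the left diagram together with the points of the right diagram. -/
def juxtRel (eA : A₂ ≃ A ⊕ A') (eB : B₂ ≃ B ⊕ B') (r : Setoid (A ⊕ B)) (r' : Setoid (A' ⊕ B')) :
    Setoid (A₂ ⊕ B₂) :=
  (sumRel r r').comap ((Equiv.sumCongr eA eB).trans (Equiv.sumSumSumComm A A' B B'))

variable (eA : A₂ ≃ A ⊕ A') (eB : B₂ ≃ B ⊕ B') (eC : C₂ ≃ C ⊕ C')
  (r : Setoid (A ⊕ B)) (r' : Setoid (A' ⊕ B')) (s : Setoid (B ⊕ C)) (s' : Setoid (B' ⊕ C'))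

def splitStack : A₂ ⊕ B₂ ⊕ C₂ → (A ⊕ B ⊕ C) ⊕ (A' ⊕ B' ⊕ C') :=
  Sum.elim (fun a => Sum.map Sum.inl Sum.inl (eA a))
    (Sum.elim (fun b => Sum.map (Sum.inr ∘ Sum.inl) (Sum.inr ∘ Sum.inl) (eB b))
      (fun c => Sum.map (Sum.inr ∘ Sum.inr) (Sum.inr ∘ Sum.inr) (eC c)))

theorem sumRel_map {X X' Y Y' : Type} {r : Setoid X} {r' : Setoid X'} {s : Setoid Y}
    {s' : Setoid Y'} {f : X → Y} {g : X' → Y'} (hf : ∀ a b, r a b → s (f a) (f b))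
    (hg : ∀ a b, r' a b → s' (g a) (g b)) {x y : X ⊕ X'} (h : sumRel r r' x y) :
    sumRel s s' (Sum.map f g x) (Sum.map f g y) := by
  rcases h with h | h
  · exact Sum.LiftRel.inl (hf _ _ h)
  · exact Sum.LiftRel.inr (hg _ _ h)

def leftLift : A ⊕ B ⊕ C → A₂ ⊕ B₂ ⊕ C₂ :=
  Sum.map (eA.symm ∘ Sum.inl) (Sum.map (eB.symm ∘ Sum.inl) (eC.symm ∘ Sum.inl))

def rightLift : A' ⊕ B' ⊕ C' → A₂ ⊕ B₂ ⊕ C₂ :=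
  Sum.map (eA.symm ∘ Sum.inr) (Sum.map (eB.symm ∘ Sum.inr) (eC.symm ∘ Sum.inr))

theorem splitStack_left (x : A ⊕ B ⊕ C) :
    splitStack eA eB eC (leftLift eA eB eC x) = Sum.inl x := by
  rcases x with x | x | x <;> simp [splitStack, leftLift]

theorem splitStack_right (x : A' ⊕ B' ⊕ C') :
    splitStack eA eB eC (rightLift eA eB eC x) = Sum.inr x := by
  rcases x with x | x | x <;> simp [splitStack, rightLift]

theorem exists_lift (x : A₂ ⊕ B₂ ⊕ C₂) :
    (∃ u, x = leftLift eA eB eC u) ∨ ∃ u, x = rightLift eA eB eC u := by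
  rcases x with x | x | x
  · obtain ⟨y, rfl⟩ := eA.symm.surjective x
    rcases y with y | y
    · exact Or.inl ⟨Sum.inl y, rfl⟩
    · exact Or.inr ⟨Sum.inl y, rfl⟩
  · obtain ⟨y, rfl⟩ := eB.symm.surjective x
    rcases y with y | y
    · exact Or.inl ⟨Sum.inr (Sum.inl y), rfl⟩
    · exact Or.inr ⟨Sum.inr (Sum.inl y), rfl⟩
  · obtain ⟨y, rfl⟩ := eC.symm.surjective x
    rcases y with y | y
    · exact Or.inl ⟨Sum.inr (Sum.inr y), rfl⟩
    · exact Or.inr ⟨Sum.inr (Sum.inr y), rfl⟩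

theorem stack_juxtRel (x y : A₂ ⊕ B₂ ⊕ C₂) :
    stack (juxtRel eA eB r r') (juxtRel eB eC s s') x y ↔
      sumRel (stack r s) (stack r' s') (splitStack eA eB eC x) (splitStack eA eB eC y) := by
  constructor
  · refine glue_le (t := (sumRel (stack r s) (stack r' s')).comap (splitStack eA eB eC))
      (fun a b hab => ?_) (fun a b hab => ?_)
    · have e : ∀ a : A₂ ⊕ B₂, splitStack eA eB eC (Sum.map id Sum.inl a) =
          Sum.map (Sum.map id Sum.inl) (Sum.map id Sum.inl)
            ((Equiv.sumCongr eA eB).trans (Equiv.sumSumSumComm A A' B B') a) := by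
        rintro (a | a)
        · obtain ⟨z, rfl⟩ := eA.symm.surjective a
          rcases z with z | z <;> simp [splitStack]
        · obtain ⟨z, rfl⟩ := eB.symm.surjective a
          rcases z with z | z <;> simp [splitStack]
      change sumRel _ _ (splitStack _ _ _ _) (splitStack _ _ _ _)
      rw [e, e]
      exact sumRel_map (fun _ _ => glue_left) (fun _ _ => glue_left) hab
    · have e : ∀ a : B₂ ⊕ C₂, splitStack eA eB eC (Sum.inr a) =
          Sum.map Sum.inr Sum.inr
            ((Equiv.sumCongr eB eC).trans (Equiv.sumSumSumComm B B' C C') a) := by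
        rintro (a | a)
        · obtain ⟨z, rfl⟩ := eB.symm.surjective a
          rcases z with z | z <;> simp [splitStack]
        · obtain ⟨z, rfl⟩ := eC.symm.surjective a
          rcases z with z | z <;> simp [splitStack]
      change sumRel _ _ (splitStack _ _ _ _) (splitStack _ _ _ _)
      rw [e, e]
      exact sumRel_map (fun _ _ => glue_right) (fun _ _ => glue_right) hab
  · intro h
    have hl : ∀ u v, stack r s u v → stack (juxtRel eA eB r r') (juxtRel eB eC s s')
        (leftLift eA eB eC u) (leftLift eA eB eC v) := by
      intro u v
      refine glue_le (t := (stack (juxtRel eA eB r r') (juxtRel eB eC s s')).comap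
        (leftLift eA eB eC)) (fun a b hab => ?_) (fun a b hab => ?_)
      · have : juxtRel eA eB r r' (Sum.map (eA.symm ∘ Sum.inl) (eB.symm ∘ Sum.inl) a)
            (Sum.map (eA.symm ∘ Sum.inl) (eB.symm ∘ Sum.inl) b) := by
          rw [juxtRel, Setoid.comap_rel]
          have hab' : sumRel r r' (Sum.inl a) (Sum.inl b) := Sum.LiftRel.inl hab
          rcases a with a | a <;> rcases b with b | b <;> simpa using hab'
        have := glue_left (φ := (Sum.map id Sum.inl : A₂ ⊕ B₂ → A₂ ⊕ B₂ ⊕ C₂)) (ψ := Sum.inr)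
          (s := juxtRel eB eC s s') this
        rcases a with a | a <;> rcases b with b | b <;> exact this
      · have : juxtRel eB eC s s' (Sum.map (eB.symm ∘ Sum.inl) (eC.symm ∘ Sum.inl) a)
            (Sum.map (eB.symm ∘ Sum.inl) (eC.symm ∘ Sum.inl) b) := by
          rw [juxtRel, Setoid.comap_rel]
          have hab' : sumRel s s' (Sum.inl a) (Sum.inl b) := Sum.LiftRel.inl hab
          rcases a with a | a <;> rcases b with b | b <;> simpa using hab'
        exact glue_right this
    have hr : ∀ u v, stack r' s' u v → stack (juxtRel eA eB r r') (juxtRel eB eC s s')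
        (rightLift eA eB eC u) (rightLift eA eB eC v) := by
      intro u v
      refine glue_le (t := (stack (juxtRel eA eB r r') (juxtRel eB eC s s')).comap
        (rightLift eA eB eC)) (fun a b hab => ?_) (fun a b hab => ?_)
      · have : juxtRel eA eB r r' (Sum.map (eA.symm ∘ Sum.inr) (eB.symm ∘ Sum.inr) a)
            (Sum.map (eA.symm ∘ Sum.inr) (eB.symm ∘ Sum.inr) b) := by
          rw [juxtRel, Setoid.comap_rel]
          have hab' : sumRel r r' (Sum.inr a) (Sum.inr b) := Sum.LiftRel.inr hab
          rcases a with a | a <;> rcases b with b | b <;> simpa using hab'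
        have := glue_left (φ := (Sum.map id Sum.inl : A₂ ⊕ B₂ → A₂ ⊕ B₂ ⊕ C₂)) (ψ := Sum.inr)
          (s := juxtRel eB eC s s') this
        rcases a with a | a <;> rcases b with b | b <;> exact this
      · have : juxtRel eB eC s s' (Sum.map (eB.symm ∘ Sum.inr) (eC.symm ∘ Sum.inr) a)
            (Sum.map (eB.symm ∘ Sum.inr) (eC.symm ∘ Sum.inr) b) := by
          rw [juxtRel, Setoid.comap_rel]
          have hab' : sumRel s s' (Sum.inr a) (Sum.inr b) := Sum.LiftRel.inr hab
          rcases a with a | a <;> rcases b with b | b <;> simpa using hab'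
        exact glue_right this
    rcases exists_lift eA eB eC x with ⟨u, rfl⟩ | ⟨u, rfl⟩ <;>
      rcases exists_lift eA eB eC y with ⟨v, rfl⟩ | ⟨v, rfl⟩ <;>
        simp only [splitStack_left, splitStack_right] at h <;> cases h
    · exact hl _ _ ‹_›
    · exact hr _ _ ‹_›

theorem splitStack_outer (v : A₂ ⊕ C₂) :
    splitStack eA eB eC (outer v) =
      Sum.map outer outer ((Equiv.sumCongr eA eC).trans (Equiv.sumSumSumComm A A' C C') v) := by
  rcases v with a | a
  · obtain ⟨z, rfl⟩ := eA.symm.surjective a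
    rcases z with z | z <;> simp [splitStack, outer]
  · obtain ⟨z, rfl⟩ := eC.symm.surjective a
    rcases z with z | z <;> simp [splitStack, outer]

theorem stackOuter_juxtRel :
    stackOuter (juxtRel eA eB r r') (juxtRel eB eC s s') =
      juxtRel eA eC (stackOuter r s) (stackOuter r' s') := by
  ext x y
  refine (stack_juxtRel eA eB eC r r' s s' (outer x) (outer y)).trans ?_
  rw [splitStack_outer, splitStack_outer]
  change _ ↔ sumRel (stackOuter r s) (stackOuter r' s')
    (((Equiv.sumCongr eA eC).trans (Equiv.sumSumSumComm A A' C C')) x)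
    (((Equiv.sumCongr eA eC).trans (Equiv.sumSumSumComm A A' C C')) y)
  generalize ((Equiv.sumCongr eA eC).trans (Equiv.sumSumSumComm A A' C C')) x = x
  generalize ((Equiv.sumCongr eA eC).trans (Equiv.sumSumSumComm A A' C C')) y = y
  constructor
  · intro h
    rcases x with x | x <;> rcases y with y | y <;> cases h
    · exact Sum.LiftRel.inl ‹_›
    · exact Sum.LiftRel.inr ‹_›
  · intro h
    exact sumRel_map (r := stackOuter r s) (r' := stackOuter r' s') (s := stack r s)
      (s' := stack r' s') (f := outer) (g := outer) (fun _ _ h => h) (fun _ _ h => h) h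

theorem loopCount_juxtRel [Finite A₂] [Finite B₂] [Finite C₂] :
    loopCount (juxtRel eA eB r r') (juxtRel eB eC s s') = loopCount r s + loopCount r' s' := by
  have hJ := stack_juxtRel eA eB eC r r' s s'
  have cl : ∀ u, (∀ v, ¬ stack (juxtRel eA eB r r') (juxtRel eB eC s s')
      (leftLift eA eB eC u) (outer v)) ↔ ∀ w, ¬ stack r s u (outer w) := by
    intro u
    simp only [hJ, splitStack_left, splitStack_outer]
    rw [((Equiv.sumCongr eA eC).trans (Equiv.sumSumSumComm A A' C C')).forall_congr_left]
    simp only [Equiv.apply_symm_apply]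
    constructor
    · exact fun h w hw => h (Sum.inl w) (Sum.LiftRel.inl hw)
    · rintro h (w | w) hw
      · cases hw
        exact h w ‹_›
      · cases hw
  have cr : ∀ u, (∀ v, ¬ stack (juxtRel eA eB r r') (juxtRel eB eC s s')
      (rightLift eA eB eC u) (outer v)) ↔ ∀ w, ¬ stack r' s' u (outer w) := by
    intro u
    simp only [hJ, splitStack_right, splitStack_outer]
    rw [((Equiv.sumCongr eA eC).trans (Equiv.sumSumSumComm A A' C C')).forall_congr_left]
    simp only [Equiv.apply_symm_apply]
    constructor
    · exact fun h w hw => h (Sum.inr w) (Sum.LiftRel.inr hw)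
    · rintro h (w | w) hw
      · cases hw
      · cases hw
        exact h w ‹_›
  have hl : ∀ u v, stack r s u v ↔ stack (juxtRel eA eB r r') (juxtRel eB eC s s')
      (leftLift eA eB eC u) (leftLift eA eB eC v) := by
    intro u v
    rw [hJ, splitStack_left, splitStack_left]
    exact ⟨Sum.LiftRel.inl, fun h => by cases h; assumption⟩
  have hr : ∀ u v, stack r' s' u v ↔ stack (juxtRel eA eB r r') (juxtRel eB eC s s')
      (rightLift eA eB eC u) (rightLift eA eB eC v) := by
    intro u v
    rw [hJ, splitStack_right, splitStack_right]
    exact ⟨Sum.LiftRel.inr, fun h => by cases h; assumption⟩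
  rw [loopCount, countOn_split _ _ (fun x => ∃ u, splitStack eA eB eC x = Sum.inr u)]
  · congr 1
    · symm
      refine countOn_congr (leftLift eA eB eC) (fun u hu => ⟨(cl u).2 hu, ?_⟩)
        (fun u v _ _ => hl u v) (fun y hy => ?_)
      · rintro ⟨u', h⟩
        rw [splitStack_left] at h
        cases h
      · rcases exists_lift eA eB eC y with ⟨u, rfl⟩ | ⟨u, rfl⟩
        · exact ⟨u, (cl u).1 hy.1, Setoid.refl' _ _⟩
        · exact absurd ⟨u, splitStack_right eA eB eC u⟩ hy.2
    · symm
      refine countOn_congr (rightLift eA eB eC)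
        (fun u hu => ⟨(cr u).2 hu, u, splitStack_right eA eB eC u⟩)
        (fun u v _ _ => hr u v) (fun y hy => ?_)
      rcases exists_lift eA eB eC y with ⟨u, rfl⟩ | ⟨u, rfl⟩
      · obtain ⟨-, u', h⟩ := hy
        rw [splitStack_left] at h
        cases h
      · exact ⟨u, (cr u).1 hy.1, Setoid.refl' _ _⟩
  · rintro x y h ⟨u, hu⟩
    rw [hJ, hu] at h
    generalize splitStack eA eB eC y = z at h ⊢
    cases h
    exact ⟨_, rfl⟩

end Juxtapose

/-- A simple Temperley-Lieb diagram without loops from `m` points on the bottom edge to `n` points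
on the top edge of the square, up to planar isotopy: it is determined by which of the points are
joined by an arc, and this is an arbitrary noncrossing perfect matching of the points. -/
@[ext]
structure Diagram (m n : ℕ) where
  rel : Setoid (Fin m ⊕ Fin n)
  pairing : IsPairing rel
  noncrossing : IsNoncrossing circlePos rel

namespace Diagram

/-- The diagram consisting of `n` through-strings. -/
def one (n : ℕ) : Diagram n n := ⟨idRel (Fin n), (idRel_planar n).1, (idRel_planar n).2⟩

/-- The diagram obtained by stacking `g` on top of `f` and removing all the loops. -/
def comp {m n k : ℕ} (f : Diagram m n) (g : Diagram n k) : Diagram m k where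
  rel := stackOuter f.rel g.rel
  pairing := (stackOuter_planar f.pairing f.noncrossing g.pairing g.noncrossing).1
  noncrossing := (stackOuter_planar f.pairing f.noncrossing g.pairing g.noncrossing).2

/-- The number of loops that arise when `g` is stacked on top of `f`. -/
noncomputable def loops {m n k : ℕ} (f : Diagram m n) (g : Diagram n k) : ℕ :=
  loopCount f.rel g.rel

/-- The diagram with `f` on the left and `g` on the right. -/
def juxtapose {m n m' n' : ℕ} (f : Diagram m n) (g : Diagram m' n') :
    Diagram (m + m') (n + n') where
  rel := juxtRel finSumFinEquiv.symm finSumFinEquiv.symm f.rel g.rel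
  pairing := by
    intro x
    obtain ⟨x, rfl⟩ := ((Equiv.sumCongr finSumFinEquiv.symm finSumFinEquiv.symm).trans
      (Equiv.sumSumSumComm (Fin m) (Fin m') (Fin n) (Fin n'))).symm.surjective x
    set E := (Equiv.sumCongr finSumFinEquiv.symm finSumFinEquiv.symm).trans
      (Equiv.sumSumSumComm (Fin m) (Fin m') (Fin n) (Fin n'))
    have hE : ∀ x y, juxtRel finSumFinEquiv.symm finSumFinEquiv.symm f.rel g.rel (E.symm x) y ↔
        sumRel f.rel g.rel x (E y) := by
      intro x y
      change sumRel f.rel g.rel (E (E.symm x)) (E y) ↔ _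
      rw [E.apply_symm_apply]
    rcases x with x | x
    · obtain ⟨y, ⟨h₁, h₂⟩, h₃⟩ := f.pairing x
      refine ⟨E.symm (Sum.inl y), ⟨fun h => h₁ (Sum.inl_injective (E.symm.injective h)), ?_⟩, ?_⟩
      · rw [hE, E.apply_symm_apply]
        exact Sum.LiftRel.inl h₂
      · intro z hz
        obtain ⟨z, rfl⟩ := E.symm.surjective z
        rw [hE, E.apply_symm_apply] at hz
        obtain ⟨hz, hz'⟩ := hz
        rcases z with z | z <;> cases hz'
        rw [h₃ z ⟨fun h => hz (by rw [h]), ‹_›⟩]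
    · obtain ⟨y, ⟨h₁, h₂⟩, h₃⟩ := g.pairing x
      refine ⟨E.symm (Sum.inr y), ⟨fun h => h₁ (Sum.inr_injective (E.symm.injective h)), ?_⟩, ?_⟩
      · rw [hE, E.apply_symm_apply]
        exact Sum.LiftRel.inr h₂
      · intro z hz
        obtain ⟨z, rfl⟩ := E.symm.surjective z
        rw [hE, E.apply_symm_apply] at hz
        obtain ⟨hz, hz'⟩ := hz
        rcases z with z | z <;> cases hz'
        rw [h₃ z ⟨fun h => hz (by rw [h]), ‹_›⟩]
  noncrossing := by
    set E := (Equiv.sumCongr finSumFinEquiv.symm finSumFinEquiv.symm).trans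
      (Equiv.sumSumSumComm (Fin m) (Fin m') (Fin n) (Fin n')) with hEdef
    let P : (Fin m ⊕ Fin n) ⊕ (Fin m' ⊕ Fin n') → ℤ := fun z => circlePos (E.symm z)
    have hl : ∀ x : Fin m ⊕ Fin n, P (Sum.inl x) = circlePos x := by
      rintro (x | x) <;> simp [P, hEdef, circlePos]
    have hr : ∀ x : Fin m' ⊕ Fin n',
        P (Sum.inr x) = if 0 ≤ circlePos x then circlePos x + m else circlePos x - n := by
      rintro (x | x)
      · simp [P, hEdef, circlePos, add_comm]
      · simp [P, hEdef, circlePos]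
        omega
    have bl : ∀ x : Fin m ⊕ Fin n, -(n : ℤ) ≤ circlePos x ∧ circlePos x < m := by
      rintro (x | x) <;> simp only [circlePos] <;> omega
    have main : ∀ a b c d, P a < P b → P b < P c → P c < P d → sumRel f.rel g.rel a c →
        sumRel f.rel g.rel b d → False := by
      rintro _ _ _ _ hab hbc hcd (@⟨a, c, hac⟩ | @⟨a, c, hac⟩) (@⟨b, d, hbd⟩ | @⟨b, d, hbd⟩)
      · simp only [hl] at hab hbc hcd
        exact f.noncrossing a b c d hab hbc hcd hac hbd
      · have h₁ := bl a
        have h₂ := bl c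
        simp only [hl, hr] at hab hbc hcd
        split_ifs at hab hbc <;> omega
      · have h₁ := bl b
        have h₂ := bl d
        simp only [hl, hr] at hab hbc hcd
        split_ifs at hcd hbc <;> omega
      · simp only [hr] at hab hbc hcd
        refine g.noncrossing a b c d ?_ ?_ ?_ hac hbd
        · split_ifs at hab <;> omega
        · split_ifs at hbc <;> omega
        · split_ifs at hcd <;> omega
    intro a b c d hab hbc hcd hac hbd
    refine main (E a) (E b) (E c) (E d) ?_ ?_ ?_ hac hbd <;>
      simpa only [P, E.symm_apply_apply]

/-- The cup, joining two points on the top edge. -/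
def cup : Diagram 0 2 where
  rel := ⊤
  pairing := by
    rintro (x | x)
    · exact x.elim0
    · refine ⟨Sum.inr (Fin.rev x), ⟨fun h => ?_, trivial⟩, ?_⟩
      · have := congrArg Fin.val (Sum.inr_injective h)
        simp only [Fin.val_rev] at this
        omega
      · rintro (y | y) ⟨h, -⟩
        · exact y.elim0
        · refine congrArg Sum.inr (Fin.ext ?_)
          have : (y : ℕ) ≠ x := fun h' => h (congrArg Sum.inr (Fin.ext h'))
          rw [Fin.val_rev]
          omega
  noncrossing := by
    rintro (a | a) (b | b) (c | c) (d | d) hab hbc hcd - - <;>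
      simp only [circlePos] at hab hbc hcd <;> omega

/-- The cap, joining two points on the bottom edge. -/
def cap : Diagram 2 0 where
  rel := ⊤
  pairing := by
    rintro (x | x)
    · refine ⟨Sum.inl (Fin.rev x), ⟨fun h => ?_, trivial⟩, ?_⟩
      · have := congrArg Fin.val (Sum.inl_injective h)
        simp only [Fin.val_rev] at this
        omega
      · rintro (y | y) ⟨h, -⟩
        · refine congrArg Sum.inl (Fin.ext ?_)
          have : (y : ℕ) ≠ x := fun h' => h (congrArg Sum.inl (Fin.ext h'))
          rw [Fin.val_rev]
          omega
        · exact y.elim0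
    · exact x.elim0
  noncrossing := by
    rintro (a | a) (b | b) (c | c) (d | d) hab hbc hcd - - <;>
      simp only [circlePos] at hab hbc hcd <;> omega

theorem one_comp {m n : ℕ} (f : Diagram m n) : (one m).comp f = f :=
  Diagram.ext (stackOuter_idRel f.rel)

theorem comp_one {m n : ℕ} (f : Diagram m n) : f.comp (one n) = f :=
  Diagram.ext (stackOuter_comp_idRel f.rel)

theorem comp_assoc {m n k l : ℕ} (f : Diagram m n) (g : Diagram n k) (h : Diagram k l) :
    (f.comp g).comp h = f.comp (g.comp h) :=
  Diagram.ext (stackOuter_assoc f.rel g.rel h.rel)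

theorem loops_assoc {m n k l : ℕ} (f : Diagram m n) (g : Diagram n k) (h : Diagram k l) :
    f.loops g + (f.comp g).loops h = g.loops h + f.loops (g.comp h) :=
  loopCount_assoc f.rel g.rel h.rel

theorem juxtapose_comp {m n k m' n' k' : ℕ} (f : Diagram m n) (g : Diagram n k)
    (f' : Diagram m' n') (g' : Diagram n' k') :
    (f.juxtapose f').comp (g.juxtapose g') = (f.comp g).juxtapose (f'.comp g') :=
  Diagram.ext (stackOuter_juxtRel _ _ _ f.rel f'.rel g.rel g'.rel)

theorem juxtapose_loops {m n k m' n' k' : ℕ} (f : Diagram m n) (g : Diagram n k)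
    (f' : Diagram m' n') (g' : Diagram n' k') :
    (f.juxtapose f').loops (g.juxtapose g') = f.loops g + f'.loops g' :=
  loopCount_juxtRel _ _ _ f.rel f'.rel g.rel g'.rel

end Diagram

open CategoryTheory

/-- The field `ℂ(q)` of rational functions in a formal parameter `q`. -/
abbrev GroundField : Type := RatFunc ℂ

noncomputable section

/-- The formal parameter. -/
def q : GroundField := RatFunc.X

/-- The quantum integer `[n]`. -/
def quantumInt (n : ℕ) : GroundField := (q ^ n - q⁻¹ ^ n) / (q - q⁻¹)

/-- The value `d = [2]` of a loop. -/
def loopValue : GroundField := q + q⁻¹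

/-- Linear combinations of simple diagrams. By the relation that removes a loop at the cost of a
factor `d`, the diagrams without loops are a basis. -/
abbrev FormalDiagram (m n : ℕ) : Type := Diagram m n →₀ GroundField

namespace FormalDiagram

/-- Composition of formal diagrams (`g` on top of `f`), as a bilinear map. -/
def comp (m n k : ℕ) :
    FormalDiagram m n →ₗ[GroundField] FormalDiagram n k →ₗ[GroundField] FormalDiagram m k :=
  Finsupp.linearCombination GroundField fun f =>
    Finsupp.linearCombination GroundField fun g =>
      Finsupp.single (f.comp g) (loopValue ^ f.loops g)

/-- Juxtaposition of formal diagrams, as a bilinear map. -/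
def juxtapose (m n m' n' : ℕ) :
    FormalDiagram m n →ₗ[GroundField] FormalDiagram m' n' →ₗ[GroundField]
      FormalDiagram (m + m') (n + n') :=
  Finsupp.linearCombination GroundField fun f =>
    Finsupp.linearCombination GroundField fun g => Finsupp.single (f.juxtapose g) 1

theorem comp_single {m n k : ℕ} (f : Diagram m n) (g : Diagram n k) (a b : GroundField) :
    comp m n k (Finsupp.single f a) (Finsupp.single g b) =
      Finsupp.single (f.comp g) (a * b * loopValue ^ f.loops g) := by
  simp only [comp, Finsupp.linearCombination_single, LinearMap.smul_apply, Finsupp.smul_single,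
    smul_eq_mul, mul_assoc]

theorem juxtapose_single {m n m' n' : ℕ} (f : Diagram m n) (g : Diagram m' n')
    (a b : GroundField) :
    juxtapose m n m' n' (Finsupp.single f a) (Finsupp.single g b) =
      Finsupp.single (f.juxtapose g) (a * b) := by
  simp only [juxtapose, Finsupp.linearCombination_single, LinearMap.smul_apply,
    Finsupp.smul_single, smul_eq_mul, mul_one]

theorem one_comp {m n : ℕ} (f : FormalDiagram m n) :
    comp m m n (Finsupp.single (Diagram.one m) 1) f = f := by
  induction f using Finsupp.induction_linear with
  | zero => exact map_zero _
  | add f g hf hg => rw [map_add, hf, hg]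
  | single f a =>
    rw [comp_single, Diagram.one_comp, show (Diagram.one m).loops f = 0 from loopCount_idRel _,
      pow_zero, mul_one, one_mul]

theorem comp_one {m n : ℕ} (f : FormalDiagram m n) :
    comp m n n f (Finsupp.single (Diagram.one n) 1) = f := by
  induction f using Finsupp.induction_linear with
  | zero => rw [map_zero, LinearMap.zero_apply]
  | add f g hf hg => rw [map_add, LinearMap.add_apply, hf, hg]
  | single f a =>
    rw [comp_single, Diagram.comp_one, show f.loops (Diagram.one n) = 0 from
      loopCount_comp_idRel _, pow_zero, mul_one, mul_one]

theorem comp_assoc {m n k l : ℕ} (f : FormalDiagram m n) (g : FormalDiagram n k)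
    (h : FormalDiagram k l) :
    comp m k l (comp m n k f g) h = comp m n l f (comp n k l g h) := by
  induction f using Finsupp.induction_linear with
  | zero => simp only [map_zero, LinearMap.zero_apply]
  | add f f' hf hf' => simp only [map_add, LinearMap.add_apply, hf, hf']
  | single f a =>
    induction g using Finsupp.induction_linear with
    | zero => simp only [map_zero, LinearMap.zero_apply]
    | add g g' hg hg' => simp only [map_add, LinearMap.add_apply, hg, hg']
    | single g b =>
      induction h using Finsupp.induction_linear with
      | zero => simp only [map_zero]
      | add h h' hh hh' => simp only [map_add, hh, hh']
      | single h c =>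
        simp only [comp_single]
        have e : loopValue ^ f.loops g * loopValue ^ (f.comp g).loops h =
            loopValue ^ g.loops h * loopValue ^ f.loops (g.comp h) := by
          rw [← pow_add, ← pow_add, Diagram.loops_assoc]
        rw [Diagram.comp_assoc]
        congr 1
        linear_combination (a * b * c) * e

theorem juxtapose_comp {m n k m' n' k' : ℕ} (f : FormalDiagram m n) (g : FormalDiagram n k)
    (f' : FormalDiagram m' n') (g' : FormalDiagram n' k') :
    comp _ _ _ (juxtapose m n m' n' f f') (juxtapose n k n' k' g g') =
      juxtapose m k m' k' (comp m n k f g) (comp m' n' k' f' g') := by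
  induction f using Finsupp.induction_linear with
  | zero => simp only [map_zero, LinearMap.zero_apply]
  | add f₁ f₂ h₁ h₂ => simp only [map_add, LinearMap.add_apply, h₁, h₂]
  | single f a =>
    induction g using Finsupp.induction_linear with
    | zero => simp only [map_zero, LinearMap.zero_apply]
    | add g₁ g₂ h₁ h₂ => simp only [map_add, LinearMap.add_apply, h₁, h₂]
    | single g b =>
      induction f' using Finsupp.induction_linear with
      | zero => simp only [map_zero, LinearMap.zero_apply]
      | add f₁ f₂ h₁ h₂ => simp only [map_add, LinearMap.add_apply, h₁, h₂]
      | single f' a' =>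
        induction g' using Finsupp.induction_linear with
        | zero => simp only [map_zero]
        | add g₁ g₂ h₁ h₂ => simp only [map_add, h₁, h₂]
        | single g' b' =>
          simp only [comp_single, juxtapose_single]
          rw [Diagram.juxtapose_comp, Diagram.juxtapose_loops, pow_add]
          congr 1
          ring

end FormalDiagram

/-- The objects of the generic Temperley-Lieb category. -/
structure TL : Type where
  points : ℕ

namespace TL

instance : Category TL where
  Hom x y := FormalDiagram x.points y.points
  id x := Finsupp.single (Diagram.one x.points) 1
  comp f g := FormalDiagram.comp _ _ _ f g
  id_comp f := FormalDiagram.one_comp f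
  comp_id f := FormalDiagram.comp_one f
  assoc f g h := FormalDiagram.comp_assoc f g h

instance (x y : TL) : AddCommGroup (x ⟶ y) :=
  inferInstanceAs (AddCommGroup (FormalDiagram x.points y.points))

instance (x y : TL) : Module GroundField (x ⟶ y) :=
  inferInstanceAs (Module GroundField (FormalDiagram x.points y.points))

instance : Preadditive TL where
  add_comp _ _ _ f f' g := by
    change FormalDiagram.comp _ _ _ (f + f') g = _
    rw [map_add]
    rfl
  comp_add _ _ _ f g g' := map_add (FormalDiagram.comp _ _ _ f) g g'

instance : Linear GroundField TL where
  smul_comp _ _ _ c f g := by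
    change FormalDiagram.comp _ _ _ (c • f) g = _
    rw [map_smul]
    rfl
  comp_smul _ _ _ f c g := map_smul (FormalDiagram.comp _ _ _ f) c g

/-- A simple diagram as a morphism. -/
def ofDiagram {m n : ℕ} (f : Diagram m n) : (⟨m⟩ : TL) ⟶ ⟨n⟩ :=
  Finsupp.single f (1 : GroundField)

/-- The tensor product of objects. -/
abbrev tensorObj (x y : TL) : TL := ⟨x.points + y.points⟩

/-- The tensor product of morphisms. -/
def tensorHom {x y x' y' : TL} (f : x ⟶ y) (g : x' ⟶ y') : tensorObj x x' ⟶ tensorObj y y' :=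
  FormalDiagram.juxtapose _ _ _ _ f g

theorem tensorHom_comp {x y z x' y' z' : TL} (f : x ⟶ y) (g : y ⟶ z) (f' : x' ⟶ y')
    (g' : y' ⟶ z') : tensorHom f f' ≫ tensorHom g g' = tensorHom (f ≫ g) (f' ≫ g') :=
  FormalDiagram.juxtapose_comp f g f' g'

/-- The diagram `U` on `n + 2` points that has `n` through-strings on the left, followed by a cap
on the bottom edge and a cup on the top edge. -/
def hook (n : ℕ) : (⟨n + 2⟩ : TL) ⟶ ⟨n + 2⟩ :=
  tensorHom (𝟙 (⟨n⟩ : TL)) (ofDiagram Diagram.cap ≫ ofDiagram Diagram.cup)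

/-- The Jones-Wenzl element `p n`, by Wenzl's recursion
`p (n + 1) = p n ⊗ 1 - [n] / [n + 1] • (p n ⊗ 1) U (p n ⊗ 1)`. -/
def jonesWenzl : (n : ℕ) → ((⟨n⟩ : TL) ⟶ ⟨n⟩)
  | 0 => 𝟙 _
  | 1 => 𝟙 _
  | n + 2 =>
    let p : (⟨n + 2⟩ : TL) ⟶ ⟨n + 2⟩ := 
      tensorHom (x := ⟨n + 1⟩) (y := ⟨n + 1⟩) (jonesWenzl (n + 1)) (𝟙 (⟨1⟩ : TL))
    p - (quantumInt (n + 1) / quantumInt (n + 2)) • (p ≫ hook n ≫ p)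

end TL

section KaroubiEnvelope

open Idempotents

/-- The scalar multiplication on the morphisms of a Karoubi envelope. -/
instance karoubiModule {R C : Type*} [Ring R] [Category C] [Preadditive C] [Linear R C]
    (P Q : Karoubi C) : Module R (P ⟶ Q) :=
  letI : SMul R (P ⟶ Q) :=
    ⟨fun c f => ⟨c • f.f, by rw [Linear.smul_comp, Linear.comp_smul, f.comm]⟩⟩
  Function.Injective.module R (Karoubi.inclusionHom P Q)
    (fun _ _ h => Karoubi.hom_ext _ _ h) (fun _ _ => rfl)

instance karoubiLinear {R C : Type*} [Ring R] [Category C] [Preadditive C] [Linear R C] :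
    Linear R (Karoubi C) where
  homModule P Q := karoubiModule P Q
  smul_comp _ _ _ c f g := Karoubi.hom_ext _ _ (Linear.smul_comp _ _ _ c f.f g.f)
  comp_smul _ _ _ f c g := Karoubi.hom_ext _ _ (Linear.comp_smul _ _ _ f.f c g.f)

/-- The tensor product of objects of the Karoubi envelope of the Temperley-Lieb category. -/
def karoubiTensor (P Q : Karoubi TL) : Karoubi TL where
  X := TL.tensorObj P.X Q.X
  p := TL.tensorHom P.p Q.p
  idem := by rw [TL.tensorHom_comp, P.idem, Q.idem]

/-- The object of the Karoubi envelope of the Temperley-Lieb category that is given by the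
Jones-Wenzl idempotent on `n` points. -/
def jonesWenzlObj (h : ∀ n, TL.jonesWenzl n ≫ TL.jonesWenzl n = TL.jonesWenzl n) (n : ℕ) :
    Karoubi TL where
  X := ⟨n⟩
  p := TL.jonesWenzl n
  idem := h n

end KaroubiEnvelope

/-- Admissible triples. -/
def Admissible (a b c : ℕ) : Prop := Even (a + b + c) ∧ c ≤ a + b ∧ a ≤ b + c ∧ b ≤ a + c

end

end TemperleyLieb

open CategoryTheory TemperleyLieb

/-!
# Fusion of Jones-Wenzl idempotents

Adding a vertical strand on the right is a ring homomorphism `strand` from the endomorphisms of `n`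
to those of `n + 1`, and Wenzl's recursion reads `p (n + 2) = s - c • (s ≫ U ≫ s)` with
`s = strand (p (n + 1))` and `U = hook n`. That `p n` is idempotent is proved together with
`p (n + 1) ≫ strand (p n) = p (n + 1)` and the partial trace formula
`U ≫ strand (p (n + 1)) ≫ U = [n + 2] / [n + 1] • (strand (strand (p n)) ≫ U)`
(`JonesWenzlRelations`). The induction uses `U ≫ U = d • U`, the relation between neighbouring
hooks, the fact that `U` commutes with `strand (strand f)`, and the recursion
`[n + 2] = d [n + 1] - [n]`. It also shows that `p n` is annihilated by every hook.

A diagram that joins two neighbouring points equals, up to a nonzero power of `d`, its composite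
with the hook at these points. Hence `p a ⊗ p b` (below) and `p c` (above) annihilate every diagram
with an arc inside the block of the first `a` bottom points, of the last `b` bottom points or of
the `c` top points, since below an arc inside a block there is an arc joining two neighbours
(`IsPlanarInvolution.exists_adjacent`). The space `Hom(p a ⊗ p b, p c)` is the image of
`project a b c`, so it is spanned by the images of the split diagrams, those without an arc inside
a block.

Count the arcs between each two of the three blocks: if there are `x`, `y` and `z` of them, then
`a = x + y`, `b = x + z` and `c = y + z`, which is possible if and only if `(a, b, c)` is
admissible, and then determines `x`, `y` and `z`. By planarity the arcs between two blocks are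
concentric, so that there is exactly one split diagram if `(a, b, c)` is admissible, and none
otherwise (`IsTriad.eq_triadMap`).

Finally, the image of the split diagram is not zero: `p n` is the identity plus a combination of
diagrams with both an arc between bottom points and an arc between top points, so `project a b c`
does not change the coefficient of a split diagram (`project_sub_mem_coeffKer`).
-/

namespace TemperleyLieb

namespace Diagram

variable {m n k : ℕ}

/-! ### Diagrams and planar involutions -/

/-- Since every class of a pairing has two elements, a pairing that refines another one is equal
to it. -/
theorem ext_of_le {f g : Diagram m n} (h : f.rel ≤ g.rel) : f = g := by
  refine Diagram.ext (le_antisymm h fun x y hxy => ?_)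
  by_cases hyx : y = x
  · rw [hyx]
  obtain ⟨z, ⟨hz, hxz⟩, -⟩ := f.pairing x
  rwa [(g.pairing x).unique ⟨hyx, hxy⟩ ⟨hz, h hxz⟩]

theorem circlePos_mem (x : Fin m ⊕ Fin n) : -(n : ℤ) ≤ circlePos x ∧ circlePos x < m := by
  rcases x with x | x <;> simp only [circlePos] <;> omega

theorem exists_circlePos_eq {u : ℤ} (h₁ : -(n : ℤ) ≤ u) (h₂ : u < m) :
    ∃ x : Fin m ⊕ Fin n, circlePos x = u := by
  by_cases hu : 0 ≤ u
  · exact ⟨Sum.inl ⟨u.toNat, by omega⟩, by simp only [circlePos]; omega⟩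
  · exact ⟨Sum.inr ⟨(-u - 1).toNat, by omega⟩, by simp only [circlePos]; omega⟩

/-- An involution without fixed points of the integers `u` with `l ≤ u < r` such that no two of
the arcs joining `u` and `π u` cross. The values outside this interval are irrelevant. -/
structure IsPlanarInvolution (l r : ℤ) (π : ℤ → ℤ) : Prop where
  le_map : ∀ {u}, l ≤ u → u < r → l ≤ π u
  map_lt : ∀ {u}, l ≤ u → u < r → π u < r
  map_ne : ∀ {u}, l ≤ u → u < r → π u ≠ u
  map_map : ∀ {u}, l ≤ u → u < r → π (π u) = u
  noncrossing : ∀ {u v}, l ≤ u → v < r → u < v → v < π u → π v ≤ π u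

/-- The diagram that joins the points at the positions `u` and `π u` of the boundary circle, where
the positions run from `-n` to `m - 1` as in `circlePos`. -/
def ofInvolution (π : ℤ → ℤ) (hπ : IsPlanarInvolution (-n) m π) : Diagram m n where
  rel :=
    { r := fun x y => circlePos y = circlePos x ∨ circlePos y = π (circlePos x)
      iseqv :=
        { refl := fun _ => Or.inl rfl
          symm := by
            rintro x y (h | h)
            · exact Or.inl h.symm
            · refine Or.inr ?_
              rw [h, hπ.map_map (circlePos_mem x).1 (circlePos_mem x).2]
          trans := by
            rintro x y z (h | h) (h' | h')
            · exact Or.inl (h'.trans h)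
            · exact Or.inr (h ▸ h')
            · exact Or.inr (h'.trans h)
            · refine Or.inl ?_
              rw [h', h, hπ.map_map (circlePos_mem x).1 (circlePos_mem x).2] } }
  pairing := by
    intro x
    obtain ⟨hx₁, hx₂⟩ := circlePos_mem x
    obtain ⟨y, hy⟩ := exists_circlePos_eq (m := m) (n := n) (hπ.le_map hx₁ hx₂)
      (hπ.map_lt hx₁ hx₂)
    refine ⟨y, ⟨?_, Or.inr hy⟩, ?_⟩
    · rintro rfl
      exact hπ.map_ne hx₁ hx₂ hy.symm
    · rintro z ⟨hz, h | h⟩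
      · exact absurd (circlePos_injective h) hz
      · exact circlePos_injective (h.trans hy.symm)
  noncrossing := by
    rintro a b c d hab hbc hcd (hac | hac) (hbd | hbd)
    · omega
    · omega
    · omega
    · have := hπ.noncrossing (circlePos_mem a).1 (circlePos_mem b).2 hab (hac ▸ hbc)
      omega

/-! ### Hooks -/

/-- The diagram on `N` points with a cap that joins the points `i` and `i + 1` of the bottom edge,
a cup that joins the points `i` and `i + 1` of the top edge, and vertical strands elsewhere. -/
def hookAt (N i : ℕ) (hi : i + 1 < N) : Diagram N N :=
  ofInvolution
    (fun u => if u = i then i + 1 else if u = i + 1 then i else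
      if u = -i - 1 then -i - 2 else if u = -i - 2 then -i - 1 else -u - 1)
    (by constructor <;> intros <;> split_ifs <;> omega)

section hookAt

variable {N i : ℕ} {hi : i + 1 < N}

theorem hookAt_bottom {j k : Fin N} (hj : (j : ℕ) = i) (hk : (k : ℕ) = i + 1) :
    (hookAt N i hi).rel (Sum.inl j) (Sum.inl k) := by
  refine Or.inr ?_
  simp only [circlePos]
  split_ifs <;> omega

theorem hookAt_top {j k : Fin N} (hj : (j : ℕ) = i) (hk : (k : ℕ) = i + 1) :
    (hookAt N i hi).rel (Sum.inr j) (Sum.inr k) := by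
  refine Or.inr ?_
  simp only [circlePos]
  split_ifs <;> omega

theorem hookAt_through {j : Fin N} (hj : (j : ℕ) ≠ i) (hj' : (j : ℕ) ≠ i + 1) :
    (hookAt N i hi).rel (Sum.inl j) (Sum.inr j) := by
  refine Or.inr ?_
  simp only [circlePos]
  split_ifs <;> omega

theorem hookAt_le {s : Setoid (Fin N ⊕ Fin N)}
    (hb : ∀ j k : Fin N, (j : ℕ) = i → (k : ℕ) = i + 1 → s (Sum.inl j) (Sum.inl k))
    (ht : ∀ j k : Fin N, (j : ℕ) = i → (k : ℕ) = i + 1 → s (Sum.inr j) (Sum.inr k))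
    (hthr : ∀ j : Fin N, (j : ℕ) ≠ i → (j : ℕ) ≠ i + 1 → s (Sum.inl j) (Sum.inr j)) :
    (hookAt N i hi).rel ≤ s := by
  rintro x y (h | h)
  · rw [circlePos_injective h]
  rcases x with x | x <;> rcases y with y | y <;> simp only [circlePos] at h
  · have e : ((x : ℕ) = i ∧ (y : ℕ) = i + 1) ∨ ((y : ℕ) = i ∧ (x : ℕ) = i + 1) := by
      split_ifs at h <;> omega
    exact e.elim (fun e => hb _ _ e.1 e.2) fun e => s.symm (hb _ _ e.1 e.2)
  · have e : x = y ∧ (x : ℕ) ≠ i ∧ (x : ℕ) ≠ i + 1 := by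
      rw [Fin.ext_iff]
      split_ifs at h <;> omega
    obtain ⟨rfl, e⟩ := e
    exact hthr _ e.1 e.2
  · have e : x = y ∧ (x : ℕ) ≠ i ∧ (x : ℕ) ≠ i + 1 := by
      rw [Fin.ext_iff]
      split_ifs at h <;> omega
    obtain ⟨rfl, e⟩ := e
    exact s.symm (hthr _ e.1 e.2)
  · have e : ((x : ℕ) = i ∧ (y : ℕ) = i + 1) ∨ ((y : ℕ) = i ∧ (x : ℕ) = i + 1) := by
      split_ifs at h <;> omega
    exact e.elim (fun e => ht _ _ e.1 e.2) fun e => s.symm (ht _ _ e.1 e.2)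

/-- A diagram that joins the bottom points `i` and `i + 1` absorbs a hook at these points, up to
loops. -/
theorem hookAt_comp {f : Diagram N n} (hf : ∀ j k : Fin N, (j : ℕ) = i → (k : ℕ) = i + 1 →
    f.rel (Sum.inl j) (Sum.inl k)) : (hookAt N i hi).comp f = f := by
  refine ext_of_le fun x y hxy => ?_
  have key : f.rel (Sum.elim Sum.inl id (outer x)) (Sum.elim Sum.inl id (outer y)) :=
    glue_le (φ := Sum.map id Sum.inl) (ψ := Sum.inr)
      (t := f.rel.comap (Sum.elim Sum.inl id : Fin N ⊕ Fin N ⊕ Fin n → Fin N ⊕ Fin n))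
      (fun a b hab => hookAt_le (hi := hi)
        (s := f.rel.comap (fun x => Sum.elim Sum.inl id (Sum.map id Sum.inl x)))
        hf hf (fun _ _ _ => f.rel.refl _) hab) (fun _ _ h => h) hxy
  rcases x with x | x <;> rcases y with y | y <;> exact key

/-- A diagram that joins the top points `i` and `i + 1` absorbs a hook at these points, up to
loops. -/
theorem comp_hookAt {f : Diagram m N} (hf : ∀ j k : Fin N, (j : ℕ) = i → (k : ℕ) = i + 1 →
    f.rel (Sum.inr j) (Sum.inr k)) : f.comp (hookAt N i hi) = f := by
  refine ext_of_le fun x y hxy => ?_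
  have key : f.rel (Sum.map id (Sum.elim id id) (outer x))
      (Sum.map id (Sum.elim id id) (outer y)) :=
    glue_le (φ := Sum.map id Sum.inl) (ψ := Sum.inr)
      (t := f.rel.comap (Sum.map id (Sum.elim id id) :
        Fin m ⊕ Fin N ⊕ Fin N → Fin m ⊕ Fin N))
      (fun a b hab => by
        rcases a with a | a <;> rcases b with b | b <;> exact hab)
      (fun a b hab => hookAt_le (hi := hi)
        (s := f.rel.comap (fun x => Sum.map id (Sum.elim id id) (Sum.inr x)))
        hf hf (fun _ _ _ => f.rel.refl _) hab) hxy
  rcases x with x | x <;> rcases y with y | y <;> exact key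

end hookAt

/-! ### Arcs of stacked and juxtaposed diagrams -/

theorem comp_rel_bottom {f : Diagram m n} {a b : Fin m} (h : f.rel (Sum.inl a) (Sum.inl b))
    (g : Diagram n k) : (f.comp g).rel (Sum.inl a) (Sum.inl b) :=
  glue_left (φ := Sum.map id Sum.inl) h

theorem comp_rel_top (f : Diagram m n) {g : Diagram n k} {a b : Fin k}
    (h : g.rel (Sum.inr a) (Sum.inr b)) : (f.comp g).rel (Sum.inr a) (Sum.inr b) :=
  glue_right (ψ := Sum.inr) h

theorem juxtapose_rel_left {m' n' : ℕ} {f : Diagram m n} {x y : Fin m ⊕ Fin n} (h : f.rel x y)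
    (g : Diagram m' n') : (f.juxtapose g).rel
      (Sum.map (Fin.castAdd m') (Fin.castAdd n') x)
      (Sum.map (Fin.castAdd m') (Fin.castAdd n') y) := by
  change sumRel f.rel g.rel _ _
  have h' : sumRel f.rel g.rel (Sum.inl x) (Sum.inl y) := Sum.LiftRel.inl h
  rcases x with x | x <;> rcases y with y | y <;> simpa using h'

theorem juxtapose_rel_right {m' n' : ℕ} (f : Diagram m n) {g : Diagram m' n'}
    {x y : Fin m' ⊕ Fin n'} (h : g.rel x y) : (f.juxtapose g).rel
      (Sum.map (Fin.natAdd m) (Fin.natAdd n) x) (Sum.map (Fin.natAdd m) (Fin.natAdd n) y) := by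
  change sumRel f.rel g.rel _ _
  have h' : sumRel f.rel g.rel (Sum.inr x) (Sum.inr y) := Sum.LiftRel.inr h
  rcases x with x | x <;> rcases y with y | y <;> simpa using h'

theorem juxtapose_le {m' n' : ℕ} {f : Diagram m n} {g : Diagram m' n'}
    {s : Setoid (Fin (m + m') ⊕ Fin (n + n'))}
    (hf : ∀ x y, f.rel x y → s (Sum.map (Fin.castAdd m') (Fin.castAdd n') x)
      (Sum.map (Fin.castAdd m') (Fin.castAdd n') y))
    (hg : ∀ x y, g.rel x y → s (Sum.map (Fin.natAdd m) (Fin.natAdd n) x)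
      (Sum.map (Fin.natAdd m) (Fin.natAdd n) y)) : (f.juxtapose g).rel ≤ s := by
  intro x y h
  obtain ⟨x, rfl⟩ := ((Equiv.sumCongr finSumFinEquiv.symm finSumFinEquiv.symm).trans
    (Equiv.sumSumSumComm (Fin m) (Fin m') (Fin n) (Fin n'))).symm.surjective x
  obtain ⟨y, rfl⟩ := ((Equiv.sumCongr finSumFinEquiv.symm finSumFinEquiv.symm).trans
    (Equiv.sumSumSumComm (Fin m) (Fin m') (Fin n) (Fin n'))).symm.surjective y
  replace h : sumRel f.rel g.rel x y := by
    have h' : sumRel f.rel g.rel _ _ := h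
    simpa only [Equiv.apply_symm_apply] using h'
  rcases h with h | h
  · have := hf _ _ h
    rename_i x y
    rcases x with x | x <;> rcases y with y | y <;> simpa using this
  · have := hg _ _ h
    rename_i x y
    rcases x with x | x <;> rcases y with y | y <;> simpa using this

theorem one_rel {a : Fin n} : (one n).rel (Sum.inl a) (Sum.inr a) := rfl

theorem one_le {s : Setoid (Fin n ⊕ Fin n)} (h : ∀ a, s (Sum.inl a) (Sum.inr a)) :
    (one n).rel ≤ s := by
  rintro (a | a) (b | b) hab <;> obtain rfl : a = b := hab
  · exact s.refl _
  · exact h _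
  · exact s.symm (h _)
  · exact s.refl _

theorem one_juxtapose_one (m n : ℕ) : (one m).juxtapose (one n) = one (m + n) := by
  refine ext_of_le (juxtapose_le ?_ ?_) <;>
    rintro (a | a) (b | b) hab <;> obtain rfl : a = b := hab <;> rfl

theorem juxtapose_one_one (f : Diagram m n) :
    (f.juxtapose (one 1)).juxtapose (one 1) = f.juxtapose (one 2) := by
  refine ext_of_le (juxtapose_le (fun x y h => ?_) (fun x y h => ?_))
  · refine juxtapose_le (s := (f.juxtapose (one 2)).rel.comap
      (Sum.map (Fin.castAdd 1) (Fin.castAdd 1))) (fun x y h => ?_) (fun x y h => ?_) h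
    · have := juxtapose_rel_left h (one 2)
      rcases x with x | x <;> rcases y with y | y <;> exact this
    · have := juxtapose_rel_right f (one_rel (n := 2) (a := 0))
      rcases x with x | x <;> rcases y with y | y <;>
        obtain rfl := Subsingleton.elim x 0 <;> obtain rfl := Subsingleton.elim y 0
      · exact Setoid.refl' _ _
      · exact this
      · exact Setoid.symm' _ this
      · exact Setoid.refl' _ _
  · have := juxtapose_rel_right f (one_rel (n := 2) (a := 1))
    rcases x with x | x <;> rcases y with y | y <;>
      obtain rfl := Subsingleton.elim x 0 <;> obtain rfl := Subsingleton.elim y 0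
    · exact Setoid.refl' _ _
    · exact this
    · exact Setoid.symm' _ this
    · exact Setoid.refl' _ _

/-! ### Juxtaposition and loops of hooks, caps and cups -/

theorem hookAt_juxtapose_one {N i : ℕ} (hi : i + 1 < N) (k : ℕ) :
    (hookAt N i hi).juxtapose (one k) = hookAt (N + k) i (by omega) := by
  have hi' : i + 1 < N + k := by omega
  refine ext_of_le (juxtapose_le (fun x y h => ?_) (fun x y h => ?_))
  · exact hookAt_le (s := (hookAt (N + k) i hi').rel.comap
      (Sum.map (Fin.castAdd k) (Fin.castAdd k)))
      (fun _ _ hj hk => hookAt_bottom (hi := hi') hj hk)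
      (fun _ _ hj hk => hookAt_top (hi := hi') hj hk)
      (fun _ hj hj' => hookAt_through (hi := hi') hj hj') h
  · refine one_le (s := (hookAt (N + k) i hi').rel.comap
      (Sum.map (Fin.natAdd N) (Fin.natAdd N))) (fun a => ?_) h
    exact hookAt_through (hi := hi') (by simp only [Fin.val_natAdd]; omega)
      (by simp only [Fin.val_natAdd]; omega)

theorem one_juxtapose_hookAt {N i : ℕ} (hi : i + 1 < N) (k : ℕ) :
    (one k).juxtapose (hookAt N i hi) = hookAt (k + N) (k + i) (by omega) := by
  have hi' : k + i + 1 < k + N := by omega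
  refine ext_of_le (juxtapose_le (fun x y h => ?_) (fun x y h => ?_))
  · refine one_le (s := (hookAt (k + N) (k + i) hi').rel.comap
      (Sum.map (Fin.castAdd N) (Fin.castAdd N))) (fun a => ?_) h
    exact hookAt_through (hi := hi') (by simp only [Fin.val_castAdd]; omega)
      (by simp only [Fin.val_castAdd]; omega)
  · exact hookAt_le (s := (hookAt (k + N) (k + i) hi').rel.comap
      (Sum.map (Fin.natAdd k) (Fin.natAdd k)))
      (fun _ _ hj hk => hookAt_bottom (hi := hi') (by simp [hj]) (by simp [hk, add_assoc]))
      (fun _ _ hj hk => hookAt_top (hi := hi') (by simp [hj]) (by simp [hk, add_assoc]))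
      (fun _ hj hj' => hookAt_through (hi := hi') (by simpa using hj)
        (by simpa [add_assoc] using hj')) h

theorem one_juxtapose_cap_comp_cup (n : ℕ) :
    (one n).juxtapose (cap.comp cup) = hookAt (n + 2) n (by omega) := by
  refine (ext_of_le (hookAt_le (fun j k hj hk => ?_) (fun j k hj hk => ?_)
    (fun j hj hj' => ?_))).symm
  · obtain rfl : j = Fin.natAdd n 0 := Fin.ext hj
    obtain rfl : k = Fin.natAdd n 1 := Fin.ext hk
    exact juxtapose_rel_right (one n) (comp_rel_bottom (f := cap) (a := 0) (b := 1) trivial cup)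
  · obtain rfl : j = Fin.natAdd n 0 := Fin.ext hj
    obtain rfl : k = Fin.natAdd n 1 := Fin.ext hk
    exact juxtapose_rel_right (one n) (comp_rel_top cap (g := cup) (a := 0) (b := 1) trivial)
  · exact juxtapose_rel_left (one_rel (a := (⟨j, by omega⟩ : Fin n))) _

theorem loops_cap_cup : cap.loops cup = 0 := by
  refine countOn_eq_zero fun x hx => ?_
  rcases x with a | a | a
  · exact hx (Sum.inl a) (Setoid.refl' _ _)
  · exact a.elim0
  · exact hx (Sum.inr a) (Setoid.refl' _ _)

theorem loops_cup_cap : cup.loops cap = 1 := by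
  have h : ∀ x y, stack cup.rel cap.rel x y := by
    rintro (x | x | x) (y | y | y) <;> try first | exact Fin.elim0 x | exact Fin.elim0 y
    exact glue_right (ψ := Sum.inr) (a := Sum.inl x) (b := Sum.inl y) trivial
  rw [loops, loopCount, countOn, Nat.card_eq_one_iff_unique]
  refine ⟨⟨?_⟩, ⟨Quotient.mk _ ⟨Sum.inr (Sum.inl 0), ?_⟩⟩⟩
  · rintro ⟨x⟩ ⟨y⟩
    exact Quotient.sound (h _ _)
  · rintro (v | v) <;> exact v.elim0

theorem loops_eq_zero {f : Diagram m n} {g : Diagram n k}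
    (h : ∀ j, ∃ v : Fin m ⊕ Fin k, stack f.rel g.rel (Sum.inr (Sum.inl j)) (outer v)) :
    f.loops g = 0 := by
  refine countOn_eq_zero fun x hx => ?_
  rcases x with a | a | a
  · exact hx (Sum.inl a) (Setoid.refl' _ _)
  · obtain ⟨v, hv⟩ := h a
    exact hx v hv
  · exact hx (Sum.inr a) (Setoid.refl' _ _)

/-! ### The relation between neighbouring hooks -/

section Relations

variable {N i : ℕ}

theorem loops_hookAt_succ_hookAt (hi : i + 2 < N) :
    (hookAt N (i + 1) hi).loops (hookAt N i (by omega)) = 0 := by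
  have hi' : i + 1 < N := by omega
  refine loops_eq_zero fun j => ?_
  by_cases h₀ : (j : ℕ) = i + 2
  · exact ⟨Sum.inr j, glue_right (hookAt_through (hi := hi') (by omega) (by omega))⟩
  have hb : ∀ j : Fin N, (j : ℕ) ≠ i + 1 → (j : ℕ) ≠ i + 2 →
      stack (hookAt N (i + 1) hi).rel (hookAt N i hi').rel (Sum.inr (Sum.inl j)) (Sum.inl j) :=
    fun j h h' => Setoid.symm' _ (glue_left (φ := Sum.map id Sum.inl)
      (hookAt_through (hi := hi) h h'))
  by_cases h₁ : (j : ℕ) = i + 1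
  · refine ⟨Sum.inl ⟨i, by omega⟩, Setoid.trans' _ ?_
      (hb ⟨i, by omega⟩ (by simp) (by simp))⟩
    exact Setoid.symm' _ (glue_right (hookAt_bottom (hi := hi') rfl h₁))
  · exact ⟨Sum.inl j, hb j h₁ h₀⟩

theorem hookAt_succ_comp_hookAt_rel_cross (hi : i + 2 < N) {j k : Fin N} (hj : (j : ℕ) = i)
    (hk : (k : ℕ) = i + 2) :
    ((hookAt N (i + 1) hi).comp (hookAt N i (by omega))).rel (Sum.inl j) (Sum.inr k) := by
  have hi' : i + 1 < N := by omega
  let l : Fin N := ⟨i + 1, hi'⟩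
  have e₁ : stack (hookAt N (i + 1) hi).rel (hookAt N i hi').rel (Sum.inl j)
      (Sum.inr (Sum.inl j)) :=
    glue_left (φ := Sum.map id Sum.inl) (hookAt_through (hi := hi) (by omega) (by omega))
  have e₂ : stack (hookAt N (i + 1) hi).rel (hookAt N i hi').rel (Sum.inr (Sum.inl j))
      (Sum.inr (Sum.inl l)) := glue_right (hookAt_bottom (hi := hi') hj rfl)
  have e₃ : stack (hookAt N (i + 1) hi).rel (hookAt N i hi').rel (Sum.inr (Sum.inl l))
      (Sum.inr (Sum.inl k)) :=
    glue_left (φ := Sum.map id Sum.inl) (hookAt_top (hi := hi) rfl hk)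
  have e₄ : stack (hookAt N (i + 1) hi).rel (hookAt N i hi').rel (Sum.inr (Sum.inl k))
      (Sum.inr (Sum.inr k)) := glue_right (hookAt_through (hi := hi') (by omega) (by omega))
  exact (stack _ _).trans e₁ ((stack _ _).trans e₂ ((stack _ _).trans e₃ e₄))

theorem hookAt_succ_comp_hookAt_rel_through (hi : i + 2 < N) {j : Fin N} (h₀ : (j : ℕ) ≠ i)
    (h₁ : (j : ℕ) ≠ i + 1) (h₂ : (j : ℕ) ≠ i + 2) :
    ((hookAt N (i + 1) hi).comp (hookAt N i (by omega))).rel (Sum.inl j) (Sum.inr j) := by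
  have hi' : i + 1 < N := by omega
  have e₁ : stack (hookAt N (i + 1) hi).rel (hookAt N i hi').rel (Sum.inl j)
      (Sum.inr (Sum.inl j)) :=
    glue_left (φ := Sum.map id Sum.inl) (hookAt_through (hi := hi) h₁ h₂)
  have e₂ : stack (hookAt N (i + 1) hi).rel (hookAt N i hi').rel (Sum.inr (Sum.inl j))
      (Sum.inr (Sum.inr j)) := glue_right (hookAt_through (hi := hi') h₀ h₁)
  exact (stack _ _).trans e₁ e₂

theorem hookAt_succ_comp_hookAt_rel_top (hi : i + 2 < N) {j k : Fin N} (hj : (j : ℕ) = i)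
    (hk : (k : ℕ) = i + 1) :
    ((hookAt N (i + 1) hi).comp (hookAt N i (by omega))).rel (Sum.inr j) (Sum.inr k) :=
  comp_rel_top _ (hookAt_top hj hk)

theorem loops_hookAt_succ_comp_hookAt (hi : i + 2 < N) :
    ((hookAt N (i + 1) hi).comp (hookAt N i (by omega))).loops (hookAt N (i + 1) hi) = 0 := by
  have hi' : i + 1 < N := by omega
  set W := (hookAt N (i + 1) hi).comp (hookAt N i (by omega)) with hW
  refine loops_eq_zero fun j => ?_
  have ht : ∀ j : Fin N, (j : ℕ) ≠ i + 1 → (j : ℕ) ≠ i + 2 →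
      stack W.rel (hookAt N (i + 1) hi).rel (Sum.inr (Sum.inl j)) (Sum.inr (Sum.inr j)) :=
    fun j h h' => glue_right (hookAt_through (hi := hi) h h')
  have h₁ : ∀ j : Fin N, (j : ℕ) = i + 1 →
      stack W.rel (hookAt N (i + 1) hi).rel (Sum.inr (Sum.inl j))
        (Sum.inr (Sum.inr ⟨i, by omega⟩)) := fun j hj =>
    Setoid.trans' _ (Setoid.symm' _ (glue_left (φ := Sum.map id Sum.inl)
      (hookAt_succ_comp_hookAt_rel_top hi (j := ⟨i, by omega⟩) rfl hj)))
      (ht _ (by simp) (by simp))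
  by_cases hj : (j : ℕ) = i + 1
  · exact ⟨Sum.inr _, h₁ j hj⟩
  by_cases hj' : (j : ℕ) = i + 2
  · exact ⟨Sum.inr _, Setoid.trans' _ (Setoid.symm' _ (glue_right
      (hookAt_bottom (hi := hi) (j := ⟨i + 1, hi'⟩) rfl hj'))) (h₁ ⟨i + 1, hi'⟩ rfl)⟩
  · exact ⟨Sum.inr j, ht j hj hj'⟩

/-- Of the Temperley-Lieb relation `U (i + 1) U i U (i + 1) = U (i + 1)`, the part about arcs; no
loops arise by `loops_hookAt_succ_hookAt` and `loops_hookAt_succ_comp_hookAt`. -/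
theorem hookAt_succ_comp_hookAt_comp_hookAt_succ (hi : i + 2 < N) :
    ((hookAt N (i + 1) hi).comp (hookAt N i (by omega))).comp (hookAt N (i + 1) hi) =
      hookAt N (i + 1) hi := by
  have hi' : i + 1 < N := by omega
  set W := (hookAt N (i + 1) hi).comp (hookAt N i (by omega)) with hW
  refine (ext_of_le (hookAt_le (fun j k hj hk => ?_) (fun j k hj hk => ?_)
    fun j hj hj' => ?_)).symm
  · exact comp_rel_bottom (comp_rel_bottom (hookAt_bottom hj hk) _) _
  · exact comp_rel_top _ (hookAt_top hj hk)
  have ht : stack W.rel (hookAt N (i + 1) hi).rel (Sum.inr (Sum.inl j)) (Sum.inr (Sum.inr j)) :=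
    glue_right (hookAt_through (hi := hi) hj hj')
  by_cases h₀ : (j : ℕ) = i
  · let k : Fin N := ⟨i + 1, hi'⟩
    let l : Fin N := ⟨i + 2, hi⟩
    have e₁ : stack W.rel (hookAt N (i + 1) hi).rel (Sum.inl j) (Sum.inr (Sum.inl l)) :=
      glue_left (φ := Sum.map id Sum.inl) (hookAt_succ_comp_hookAt_rel_cross hi h₀ rfl)
    have e₂ : stack W.rel (hookAt N (i + 1) hi).rel (Sum.inr (Sum.inl k))
        (Sum.inr (Sum.inl l)) := glue_right (hookAt_bottom (hi := hi) rfl rfl)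
    have e₃ : stack W.rel (hookAt N (i + 1) hi).rel (Sum.inr (Sum.inl j))
        (Sum.inr (Sum.inl k)) :=
      glue_left (φ := Sum.map id Sum.inl) (hookAt_succ_comp_hookAt_rel_top hi h₀ rfl)
    exact (stack _ _).trans e₁ ((stack _ _).trans ((stack _ _).symm e₂)
      ((stack _ _).trans ((stack _ _).symm e₃) ht))
  · have e₁ : stack W.rel (hookAt N (i + 1) hi).rel (Sum.inl j) (Sum.inr (Sum.inl j)) :=
      glue_left (φ := Sum.map id Sum.inl)
        (hookAt_succ_comp_hookAt_rel_through hi h₀ hj hj')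
    exact (stack _ _).trans e₁ ht

end Relations

end Diagram

/-! ### Quantum integers -/

theorem q_ne_zero : q ≠ 0 := RatFunc.X_ne_zero

theorem q_pow_ne_one {n : ℕ} (hn : n ≠ 0) : q ^ n ≠ 1 := by
  intro h
  have h' : algebraMap (Polynomial ℂ) (RatFunc ℂ) (Polynomial.X ^ n) =
      algebraMap (Polynomial ℂ) (RatFunc ℂ) 1 := by
    rw [map_pow, RatFunc.algebraMap_X, map_one]
    exact h
  have := congrArg Polynomial.natDegree (RatFunc.algebraMap_injective ℂ h')
  rw [Polynomial.natDegree_X_pow, Polynomial.natDegree_one] at this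
  exact hn this

theorem q_pow_sub_ne_zero {n : ℕ} (hn : n ≠ 0) : q ^ n - q⁻¹ ^ n ≠ 0 := by
  intro h
  refine q_pow_ne_one (n := n + n) (by omega) ?_
  rw [pow_add]
  nth_rewrite 1 [sub_eq_zero.1 h]
  rw [← mul_pow, inv_mul_cancel₀ q_ne_zero, one_pow]

theorem quantumInt_ne_zero {n : ℕ} (hn : n ≠ 0) : quantumInt n ≠ 0 :=
  div_ne_zero (q_pow_sub_ne_zero hn) (by simpa using q_pow_sub_ne_zero one_ne_zero)

theorem quantumInt_one : quantumInt 1 = 1 := by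
  rw [quantumInt, pow_one, pow_one]
  exact div_self (by simpa using q_pow_sub_ne_zero one_ne_zero)

theorem quantumInt_add_two (n : ℕ) :
    quantumInt (n + 2) = loopValue * quantumInt (n + 1) - quantumInt n := by
  have h := mul_inv_cancel₀ q_ne_zero
  rw [quantumInt, quantumInt, quantumInt, loopValue, mul_div_assoc', ← sub_div]
  congr 1
  linear_combination (q⁻¹ ^ n - q ^ n) * h

theorem quantumInt_two : quantumInt 2 = loopValue := by
  have := quantumInt_add_two 0
  simpa [quantumInt_one, show quantumInt 0 = 0 by simp [quantumInt]] using this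

theorem loopValue_ne_zero : loopValue ≠ 0 := quantumInt_two ▸ quantumInt_ne_zero two_ne_zero

/-! ### Morphisms as combinations of diagrams -/

namespace TL

theorem ofDiagram_comp {m n k : ℕ} (f : Diagram m n) (g : Diagram n k) :
    ofDiagram f ≫ ofDiagram g = loopValue ^ f.loops g • ofDiagram (f.comp g) := by
  refine (FormalDiagram.comp_single f g 1 1).trans ?_
  rw [one_mul, one_mul]
  exact (Finsupp.smul_single_one _ _).symm

theorem ofDiagram_comp_of_loops_eq_zero {m n k : ℕ} {f : Diagram m n} {g : Diagram n k}
    (h : f.loops g = 0) : ofDiagram f ≫ ofDiagram g = ofDiagram (f.comp g) := by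
  rw [ofDiagram_comp, h, pow_zero, one_smul]

theorem tensorHom_ofDiagram {m n m' n' : ℕ} (f : Diagram m n) (g : Diagram m' n') :
    tensorHom (ofDiagram f) (ofDiagram g) = ofDiagram (f.juxtapose g) :=
  (FormalDiagram.juxtapose_single f g 1 1).trans (by rw [one_mul]; rfl)

theorem id_eq_ofDiagram (n : ℕ) : 𝟙 (⟨n⟩ : TL) = ofDiagram (Diagram.one n) := rfl

/-- Every morphism is a linear combination of diagrams. -/
theorem hom_induction {m n : ℕ} {P : ((⟨m⟩ : TL) ⟶ ⟨n⟩) → Prop} (zero : P 0)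
    (add : ∀ f g, P f → P g → P (f + g)) (smul : ∀ (c : GroundField) f, P f → P (c • f))
    (diagram : ∀ f, P (ofDiagram f)) (f : (⟨m⟩ : TL) ⟶ ⟨n⟩) : P f :=
  Finsupp.induction_linear (motive := P) f zero add fun D c => by
    have := smul c _ (diagram D)
    rwa [show c • ofDiagram D = Finsupp.single D c from Finsupp.smul_single_one _ _] at this

theorem tensorHom_add {x y x' y' : TL} (f : x ⟶ y) (g g' : x' ⟶ y') :
    tensorHom f (g + g') = tensorHom f g + tensorHom f g' :=
  map_add (FormalDiagram.juxtapose _ _ _ _ f) g g'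

theorem tensorHom_sub {x y x' y' : TL} (f : x ⟶ y) (g g' : x' ⟶ y') :
    tensorHom f (g - g') = tensorHom f g - tensorHom f g' :=
  map_sub (FormalDiagram.juxtapose _ _ _ _ f) g g'

theorem tensorHom_smul {x y x' y' : TL} (c : GroundField) (f : x ⟶ y) (g : x' ⟶ y') :
    tensorHom f (c • g) = c • tensorHom f g :=
  map_smul (FormalDiagram.juxtapose _ _ _ _ f) c g

theorem tensorHom_zero {x y x' y' : TL} (f : x ⟶ y) :
    tensorHom f (0 : x' ⟶ y') = 0 :=
  map_zero (FormalDiagram.juxtapose _ _ _ _ f)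

theorem add_tensorHom {x y x' y' : TL} (f f' : x ⟶ y) (g : x' ⟶ y') :
    tensorHom (f + f') g = tensorHom f g + tensorHom f' g :=
  LinearMap.map_add₂ (FormalDiagram.juxtapose _ _ _ _) f f' g

theorem sub_tensorHom {x y x' y' : TL} (f f' : x ⟶ y) (g : x' ⟶ y') :
    tensorHom (f - f') g = tensorHom f g - tensorHom f' g :=
  LinearMap.map_sub₂ (FormalDiagram.juxtapose _ _ _ _) f f' g

theorem smul_tensorHom {x y x' y' : TL} (c : GroundField) (f : x ⟶ y) (g : x' ⟶ y') :
    tensorHom (c • f) g = c • tensorHom f g :=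
  LinearMap.map_smul₂ (FormalDiagram.juxtapose _ _ _ _) c f g

theorem zero_tensorHom {x y x' y' : TL} (g : x' ⟶ y') :
    tensorHom (0 : x ⟶ y) g = 0 :=
  LinearMap.map_zero₂ (FormalDiagram.juxtapose _ _ _ _) g

/-! ### Relations between hooks and strands -/

/-- Adding a vertical strand on the right of an endomorphism. -/
noncomputable def strand {n : ℕ} (f : (⟨n⟩ : TL) ⟶ ⟨n⟩) : (⟨n + 1⟩ : TL) ⟶ ⟨n + 1⟩ :=
  tensorHom f (𝟙 (⟨1⟩ : TL))

section strand

variable {n : ℕ} (f g : (⟨n⟩ : TL) ⟶ ⟨n⟩)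

theorem strand_comp : strand (f ≫ g) = strand f ≫ strand g := by
  refine Eq.trans ?_ (tensorHom_comp f g (𝟙 (⟨1⟩ : TL)) (𝟙 _)).symm
  rw [Category.comp_id]
  rfl

theorem strand_sub : strand (f - g) = strand f - strand g := sub_tensorHom f g _

theorem strand_smul (c : GroundField) : strand (c • f) = c • strand f := smul_tensorHom c f _

theorem strand_zero : strand (0 : (⟨n⟩ : TL) ⟶ ⟨n⟩) = 0 := zero_tensorHom _

theorem strand_ofDiagram (D : Diagram n n) :
    strand (ofDiagram D) = ofDiagram (D.juxtapose (Diagram.one 1)) :=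
  tensorHom_ofDiagram D (Diagram.one 1)

theorem strand_id : strand (𝟙 (⟨n⟩ : TL)) = 𝟙 (⟨n + 1⟩ : TL) := by
  rw [id_eq_ofDiagram, strand_ofDiagram, Diagram.one_juxtapose_one]
  rfl

theorem strand_strand :
    strand (strand f) = tensorHom (x := ⟨n⟩) (y := ⟨n⟩) f (𝟙 (⟨2⟩ : TL)) := by
  induction f using hom_induction with
  | zero => rw [strand_zero, strand_zero, zero_tensorHom]
  | add f g hf hg =>
    rw [add_tensorHom, ← hf, ← hg]
    exact (congrArg strand (add_tensorHom f g _)).trans (add_tensorHom _ _ _)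
  | smul c f hf => rw [strand_smul, strand_smul, hf, smul_tensorHom]
  | diagram D =>
    rw [strand_ofDiagram, strand_ofDiagram, Diagram.juxtapose_one_one, id_eq_ofDiagram,
      tensorHom_ofDiagram]

theorem strand_strand_comp_hook : strand (strand f) ≫ hook n = hook n ≫ strand (strand f) := by
  rw [strand_strand, hook]
  refine (tensorHom_comp f (𝟙 _) (𝟙 (⟨2⟩ : TL)) _).trans
    (Eq.trans ?_ (tensorHom_comp (𝟙 _) f _ (𝟙 (⟨2⟩ : TL))).symm)
  rw [Category.id_comp, Category.id_comp, Category.comp_id, Category.comp_id]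

end strand

theorem hook_eq (n : ℕ) : hook n = ofDiagram (Diagram.hookAt (n + 2) n (by omega)) := by
  rw [hook, ofDiagram_comp_of_loops_eq_zero Diagram.loops_cap_cup, id_eq_ofDiagram,
    tensorHom_ofDiagram, Diagram.one_juxtapose_cap_comp_cup]

/-- A closed loop has the value `d`. -/
theorem cup_comp_cap : ofDiagram Diagram.cup ≫ ofDiagram Diagram.cap =
    loopValue • 𝟙 (⟨0⟩ : TL) := by
  rw [ofDiagram_comp, Diagram.loops_cup_cap, pow_one, id_eq_ofDiagram]
  congr 2
  refine Diagram.ext_of_le fun x => ?_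
  rcases x with x | x <;> exact x.elim0

theorem hook_comp_hook (n : ℕ) : hook n ≫ hook n = loopValue • hook n := by
  have h : (ofDiagram Diagram.cap ≫ ofDiagram Diagram.cup) ≫
      (ofDiagram Diagram.cap ≫ ofDiagram Diagram.cup) =
        loopValue • (ofDiagram Diagram.cap ≫ ofDiagram Diagram.cup) := by
    rw [Category.assoc, ← Category.assoc (ofDiagram Diagram.cup), cup_comp_cap,
      Linear.smul_comp, Category.id_comp, Linear.comp_smul]
  rw [hook]
  refine (tensorHom_comp (𝟙 _) (𝟙 _) _ _).trans ?_
  rw [h, Category.comp_id, tensorHom_smul]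

theorem hook_succ_comp_strand_hook_comp_hook_succ (n : ℕ) :
    hook (n + 1) ≫ strand (hook n) ≫ hook (n + 1) = hook (n + 1) := by
  rw [← Category.assoc, hook_eq, hook_eq, strand_ofDiagram, Diagram.hookAt_juxtapose_one,
    ofDiagram_comp_of_loops_eq_zero (Diagram.loops_hookAt_succ_hookAt (N := n + 1 + 2) _),
    ofDiagram_comp_of_loops_eq_zero (Diagram.loops_hookAt_succ_comp_hookAt (N := n + 1 + 2) _),
    Diagram.hookAt_succ_comp_hookAt_comp_hookAt_succ]

/-! ### The Jones-Wenzl idempotents -/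

theorem jonesWenzl_add_two (n : ℕ) : jonesWenzl (n + 2) = strand (jonesWenzl (n + 1)) -
    (quantumInt (n + 1) / quantumInt (n + 2)) •
      (strand (jonesWenzl (n + 1)) ≫ hook n ≫ strand (jonesWenzl (n + 1))) := rfl

/-- The properties of `p (n + 1)` that are carried along Wenzl's recursion; the last one computes
the partial trace of `p (n + 1)`. -/
structure JonesWenzlRelations (n : ℕ) : Prop where
  idem : jonesWenzl (n + 1) ≫ jonesWenzl (n + 1) = jonesWenzl (n + 1)
  comp_strand : jonesWenzl (n + 1) ≫ strand (jonesWenzl n) = jonesWenzl (n + 1)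
  strand_comp : strand (jonesWenzl n) ≫ jonesWenzl (n + 1) = jonesWenzl (n + 1)
  hook_comp_hook : hook n ≫ strand (jonesWenzl (n + 1)) ≫ hook n =
    (quantumInt (n + 2) / quantumInt (n + 1)) • (strand (strand (jonesWenzl n)) ≫ hook n)

namespace JonesWenzlRelations

variable {n : ℕ} (h : JonesWenzlRelations n)
include h

theorem strand_idem : strand (jonesWenzl (n + 1)) ≫ strand (jonesWenzl (n + 1)) =
    strand (jonesWenzl (n + 1)) := by rw [← TL.strand_comp, h.idem]

theorem jonesWenzl_comp_hook : jonesWenzl (n + 2) ≫ hook n = 0 := by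
  rw [jonesWenzl_add_two, Preadditive.sub_comp, Linear.smul_comp, Category.assoc, Category.assoc,
    h.hook_comp_hook, Linear.comp_smul, ← Category.assoc (strand _) (strand _), ← TL.strand_comp,
    h.comp_strand, smul_smul, div_mul_div_cancel₀ (quantumInt_ne_zero (by omega)),
    div_self (quantumInt_ne_zero (by omega)), one_smul, sub_self]

theorem hook_comp_jonesWenzl : hook n ≫ jonesWenzl (n + 2) = 0 := by
  rw [jonesWenzl_add_two, Preadditive.comp_sub, Linear.comp_smul,
    ← Category.assoc (strand _) (hook n), ← Category.assoc (hook n), h.hook_comp_hook,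
    Linear.smul_comp, strand_strand_comp_hook, Category.assoc, ← TL.strand_comp,
    h.strand_comp, smul_smul, div_mul_div_cancel₀ (quantumInt_ne_zero (by omega)),
    div_self (quantumInt_ne_zero (by omega)), one_smul, sub_self]

theorem succ : JonesWenzlRelations (n + 1) := by
  have hc : jonesWenzl (n + 2) ≫ strand (jonesWenzl (n + 1)) = jonesWenzl (n + 2) := by
    rw [jonesWenzl_add_two, Preadditive.sub_comp, Linear.smul_comp, Category.assoc,
      Category.assoc, h.strand_idem]
  refine ⟨?_, hc, ?_, ?_⟩
  · change jonesWenzl (n + 2) ≫ jonesWenzl (n + 2) = _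
    nth_rewrite 2 [jonesWenzl_add_two]
    rw [Preadditive.comp_sub, Linear.comp_smul, hc, ← Category.assoc, hc, ← Category.assoc,
      h.jonesWenzl_comp_hook, Limits.zero_comp, smul_zero, sub_zero]
  · change _ ≫ jonesWenzl (n + 2) = jonesWenzl (n + 2)
    rw [jonesWenzl_add_two, Preadditive.comp_sub, Linear.comp_smul, ← Category.assoc,
      h.strand_idem]
  · change hook (n + 1) ≫ strand (jonesWenzl (n + 2)) ≫ hook (n + 1) = _
    -- `S` is idempotent and commutes with `hook (n + 1)`, which reduces the claim to
    -- `[2] - [n + 1] / [n + 2] = [n + 3] / [n + 2]`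
    set S := strand (strand (jonesWenzl (n + 1))) with hS
    have hSS : S ≫ S = S := by rw [hS, ← TL.strand_comp, h.strand_idem]
    have hSh : S ≫ hook (n + 1) = hook (n + 1) ≫ S := strand_strand_comp_hook _
    have e : hook (n + 1) ≫ (S ≫ strand (hook n) ≫ S) ≫ hook (n + 1) = S ≫ hook (n + 1) := by
      calc _ = (hook (n + 1) ≫ S) ≫ strand (hook n) ≫ (S ≫ hook (n + 1)) := by
            simp only [Category.assoc]
        _ = S ≫ (hook (n + 1) ≫ strand (hook n) ≫ hook (n + 1)) ≫ S := by
            rw [hSh, ← hSh]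
            simp only [Category.assoc]
            rw [hSh]
        _ = _ := by
            rw [hook_succ_comp_strand_hook_comp_hook_succ, ← hSh, ← Category.assoc, hSS]
    rw [jonesWenzl_add_two, strand_sub, strand_smul, TL.strand_comp, TL.strand_comp, ← hS,
      Preadditive.sub_comp, Preadditive.comp_sub, Linear.smul_comp, Linear.comp_smul, e, hSh,
      ← Category.assoc, TL.hook_comp_hook, Linear.smul_comp, ← sub_smul]
    congr 1
    have h₂ : quantumInt (n + 2) ≠ 0 := quantumInt_ne_zero (by omega)
    have h₃ := quantumInt_add_two (n + 1)
    field_simp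
    exact h₃.symm

end JonesWenzlRelations

theorem jonesWenzlRelations (n : ℕ) : JonesWenzlRelations n := by
  induction n with
  | succ n h => exact h.succ
  | zero =>
    have h₁ : jonesWenzl (0 + 1) = 𝟙 _ := rfl
    have h₀ : jonesWenzl 0 = 𝟙 _ := rfl
    refine ⟨?_, ?_, ?_, ?_⟩
    · rw [h₁, Category.comp_id]
    · rw [h₁, h₀, strand_id]
      exact Category.comp_id _
    · rw [h₁, h₀, strand_id]
      exact Category.comp_id _
    · rw [h₁, h₀, strand_id, strand_id, strand_id, Category.id_comp, hook_comp_hook,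
        quantumInt_one, div_one, quantumInt_two]

theorem jonesWenzl_idem (n : ℕ) : jonesWenzl n ≫ jonesWenzl n = jonesWenzl n := by
  cases n with
  | zero => exact Category.comp_id _
  | succ n => exact (jonesWenzlRelations n).idem

theorem jonesWenzl_comp_hookAt {n i : ℕ} (hi : i + 1 < n) :
    jonesWenzl n ≫ ofDiagram (Diagram.hookAt n i hi) = 0 := by
  induction n with
  | zero => omega
  | succ n ih =>
    obtain ⟨n, rfl⟩ : ∃ k, n = k + 1 := ⟨n - 1, by omega⟩
    by_cases h : i = n
    · subst h
      rw [← hook_eq]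
      exact (jonesWenzlRelations i).jonesWenzl_comp_hook
    · rw [← (jonesWenzlRelations (n + 1)).comp_strand, ← Diagram.hookAt_juxtapose_one (N := n + 1)
        (by omega), ← strand_ofDiagram, Category.assoc, ← strand_comp, ih, strand_zero,
        Limits.comp_zero]

theorem hookAt_comp_jonesWenzl {n i : ℕ} (hi : i + 1 < n) :
    ofDiagram (Diagram.hookAt n i hi) ≫ jonesWenzl n = 0 := by
  induction n with
  | zero => omega
  | succ n ih =>
    obtain ⟨n, rfl⟩ : ∃ k, n = k + 1 := ⟨n - 1, by omega⟩
    by_cases h : i = n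
    · subst h
      rw [← hook_eq]
      exact (jonesWenzlRelations i).hook_comp_jonesWenzl
    · rw [← (jonesWenzlRelations (n + 1)).strand_comp, ← Diagram.hookAt_juxtapose_one (N := n + 1)
        (by omega), ← strand_ofDiagram, ← Category.assoc, ← strand_comp, ih, strand_zero,
        Limits.zero_comp]

end TL

/-! ### Arcs joining three blocks of points -/

namespace Diagram

namespace IsPlanarInvolution

variable {l r : ℤ} {π : ℤ → ℤ} (h : IsPlanarInvolution l r π)
include h

/-- The points below an arc are joined among themselves. -/
theorem nested {u v : ℤ} (hl : l ≤ u) (hr : π u < r) (huv : u < v) (hv : v < π u) :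
    u < π v ∧ π v < π u := by
  have hu := h.map_map hl (by omega)
  have hvv := h.map_map (u := v) (by omega) (by omega)
  have h₁ := h.noncrossing hl (by omega) huv hv
  have h₂ : π v ≠ π u := fun e => by rw [e] at hvv; omega
  have h₃ : π v ≠ u := fun e => by rw [e] at hvv; omega
  have h₄ : ¬ π v < u := fun h₄ => by
    have := h.noncrossing (h.le_map (u := v) (by omega) (by omega)) (by omega) h₄
      (by rw [hvv]; exact huv)
    rw [hvv] at this
    omega
  omega

/-- Below any arc there is one that joins two neighbours. -/
theorem exists_adjacent {u : ℤ} (hl : l ≤ u) (hr : π u < r) (hu : u < π u) :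
    ∃ w, u ≤ w ∧ w + 1 ≤ π u ∧ π w = w + 1 := by
  induction hd : (π u - u).toNat using Nat.strong_induction_on generalizing u with
  | _ d ih =>
    by_cases h₁ : π u = u + 1
    · exact ⟨u, le_rfl, h₁.ge, h₁⟩
    have h₂ := h.nested hl hr (v := u + 1) (by omega) (by omega)
    have h₃ := h.map_ne (u := u + 1) (by omega) (by omega)
    obtain ⟨w, hw, hw', hw''⟩ :=
      ih _ (by omega) (u := u + 1) (by omega) (by omega) (by omega) rfl
    exact ⟨w, by omega, by omega, hw''⟩

omit h in
theorem card_eq_card {s t : Finset ℤ} (hst : ∀ u ∈ s, π u ∈ t) (hts : ∀ u ∈ t, π u ∈ s)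
    (hs : ∀ u ∈ s, π (π u) = u) (ht : ∀ u ∈ t, π (π u) = u) : s.card = t.card :=
  Finset.card_bij' (fun u _ => π u) (fun u _ => π u) hst hts hs ht

end IsPlanarInvolution

/-- A planar involution of three consecutive blocks of `c`, `a` and `b` points that does not join
two points of the same block. -/
structure IsTriad (a b c : ℕ) (π : ℤ → ℤ) : Prop where
  planar : IsPlanarInvolution (-c) (a + b : ℕ) π
  top : ∀ {u}, -(c : ℤ) ≤ u → u < 0 → 0 ≤ π u
  left : ∀ {u : ℤ}, 0 ≤ u → u < a → π u < 0 ∨ a ≤ π u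
  right : ∀ {u}, (a : ℤ) ≤ u → u < (a + b : ℕ) → π u < a

namespace IsTriad

variable {a b c : ℕ} {π : ℤ → ℤ} (h : IsTriad a b c π)
include h

/-- The points between the two ends of an arc joining the left and the right block are joined
among themselves, hence there are as many of them in each of these blocks. -/
theorem add_map_of_left_right {u : ℤ} (hu : 0 ≤ u) (hu' : u < a) (hπ : a ≤ π u) :
    u + π u = 2 * a - 1 := by
  have hr := h.planar.map_lt (u := u) (by omega) (by omega)
  have := IsPlanarInvolution.card_eq_card (π := π) (s := Finset.Ico (u + 1) a)
    (t := Finset.Ico (a : ℤ) (π u))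
    (fun v hv => by
      rw [Finset.mem_Ico] at hv ⊢
      have h₁ := h.planar.nested (u := u) (v := v) (by omega) hr (by omega) (by omega)
      have h₂ := h.left (u := v) (by omega) (by omega)
      omega)
    (fun v hv => by
      rw [Finset.mem_Ico] at hv ⊢
      have h₁ := h.planar.nested (u := u) (v := v) (by omega) hr (by omega) (by omega)
      have h₂ := h.right (u := v) (by omega) (by omega)
      omega)
    (fun v hv => by
      rw [Finset.mem_Ico] at hv
      exact h.planar.map_map (by omega) (by omega))
    (fun v hv => by
      rw [Finset.mem_Ico] at hv
      exact h.planar.map_map (by omega) (by omega))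
  rw [Int.card_Ico, Int.card_Ico] at this
  omega

theorem add_map_of_top_left {u : ℤ} (hu : -(c : ℤ) ≤ u) (hu' : u < 0) (hπ : π u < a) :
    u + π u = -1 := by
  have hl := h.top hu hu'
  have := IsPlanarInvolution.card_eq_card (π := π) (s := Finset.Ico (u + 1) 0)
    (t := Finset.Ico 0 (π u))
    (fun v hv => by
      rw [Finset.mem_Ico] at hv ⊢
      have h₁ := h.planar.nested (u := u) (v := v) (by omega) (by omega) (by omega) (by omega)
      have h₂ := h.top (u := v) (by omega) (by omega)
      omega)
    (fun v hv => by
      rw [Finset.mem_Ico] at hv ⊢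
      have h₁ := h.planar.nested (u := u) (v := v) (by omega) (by omega) (by omega) (by omega)
      have h₂ := h.left (u := v) (by omega) (by omega)
      omega)
    (fun v hv => by
      rw [Finset.mem_Ico] at hv
      exact h.planar.map_map (by omega) (by omega))
    (fun v hv => by
      rw [Finset.mem_Ico] at hv
      exact h.planar.map_map (by omega) (by omega))
  rw [Int.card_Ico, Int.card_Ico] at this
  omega

/-- Here the points on the other side of the arc are counted. -/
theorem add_map_of_top_right {u : ℤ} (hu : -(c : ℤ) ≤ u) (hu' : u < 0) (hπ : a ≤ π u) :
    u + π u = a + b - c - 1 := by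
  have hr := h.planar.map_lt (u := u) (by omega) (by omega)
  have hm := h.planar.map_map (u := u) (by omega) (by omega)
  -- a point outside the arc is not joined to a point on or below it
  have out : ∀ v, -(c : ℤ) ≤ v → v < (a + b : ℕ) → (v < u ∨ π u < v) →
      π v < u ∨ π u < π v := by
    intro v h₁ h₂ h₃
    have hv := h.planar.map_map h₁ h₂
    by_contra h₄
    have h₅ : π v ≠ u := fun e => by rw [e] at hv; omega
    have h₆ : π v ≠ π u := fun e => by rw [e] at hv; omega
    have := h.planar.nested (u := u) (v := π v) (by omega) hr (by omega) (by omega)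
    omega
  have := IsPlanarInvolution.card_eq_card (π := π) (s := Finset.Ico (-(c : ℤ)) u)
    (t := Finset.Ico (π u + 1) (a + b : ℕ))
    (fun v hv => by
      rw [Finset.mem_Ico] at hv ⊢
      have h₁ := out v (by omega) (by omega) (by omega)
      have h₂ := h.top (u := v) (by omega) (by omega)
      have h₃ := h.planar.map_lt (u := v) (by omega) (by omega)
      omega)
    (fun v hv => by
      rw [Finset.mem_Ico] at hv ⊢
      have h₁ := out v (by omega) (by omega) (by omega)
      have h₂ := h.right (u := v) (by omega) (by omega)
      have h₃ := h.planar.le_map (u := v) (by omega) (by omega)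
      omega)
    (fun v hv => by
      rw [Finset.mem_Ico] at hv
      exact h.planar.map_map (by omega) (by omega))
    (fun v hv => by
      rw [Finset.mem_Ico] at hv
      exact h.planar.map_map (by omega) (by omega))
  rw [Int.card_Ico, Int.card_Ico] at this
  push_cast at this
  omega

end IsTriad

/-- The involution with `x` arcs between the left and the right block, `y` arcs between the left
and the top block and `z` arcs between the right and the top block; the arcs of each kind are
concentric. -/
def triadMap (x y : ℕ) (u : ℤ) : ℤ :=
  if u < -y then 2 * x - 1 - u else if u < y then -1 - u else
    if u < 2 * x + y then 2 * x + 2 * y - 1 - u else 2 * x - 1 - u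

theorem isTriad_triadMap (x y z : ℕ) : IsTriad (x + y) (x + z) (y + z) (triadMap x y) := by
  refine ⟨⟨?_, ?_, ?_, ?_, ?_⟩, ?_, ?_, ?_⟩ <;> intros <;> unfold triadMap at * <;> grind

/-- There is at most one way to join three blocks, and it is given by the numbers of arcs between
the blocks. -/
theorem IsTriad.eq_triadMap {a b c : ℕ} {π : ℤ → ℤ} (h : IsTriad a b c π) :
    ∃ x y z : ℕ, a = x + y ∧ b = x + z ∧ c = y + z ∧
      ∀ u, -(c : ℤ) ≤ u → u < (a + b : ℕ) → π u = triadMap x y u := by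
  classical
  have hm : ∀ {u}, -(c : ℤ) ≤ u → u < (a + b : ℕ) → π (π u) = u := h.planar.map_map
  have hle : ∀ {u}, -(c : ℤ) ≤ u → u < (a + b : ℕ) → -(c : ℤ) ≤ π u := h.planar.le_map
  have hlt : ∀ {u}, -(c : ℤ) ≤ u → u < (a + b : ℕ) → π u < (a + b : ℕ) := h.planar.map_lt
  let A := Finset.Ico (0 : ℤ) a
  let B := Finset.Ico (a : ℤ) (a + b : ℕ)
  let C := Finset.Ico (-c : ℤ) 0
  -- the two kinds of points of each block, and the bijections between the kinds given by the arcs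
  have hA : (A.filter (π · < 0)).card + (A.filter fun u => ¬ π u < 0).card = a := by
    rw [Finset.card_filter_add_card_filter_not, Int.card_Ico]
    omega
  have hB : (B.filter (π · < 0)).card + (B.filter fun u => ¬ π u < 0).card = b := by
    rw [Finset.card_filter_add_card_filter_not, Int.card_Ico]
    omega
  have hC : (C.filter (π · < a)).card + (C.filter fun u => ¬ π u < a).card = c := by
    rw [Finset.card_filter_add_card_filter_not, Int.card_Ico]
    omega
  have hAC : (C.filter (π · < a)).card = (A.filter (π · < 0)).card := by
    refine IsPlanarInvolution.card_eq_card (π := π) ?_ ?_ ?_ ?_ <;> intro u hu <;>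
      simp only [A, C, Finset.mem_filter, Finset.mem_Ico] at hu ⊢
    · have := hm (u := u) (by omega) (by omega)
      have := h.top (u := u) (by omega) (by omega)
      omega
    · have := hm (u := u) (by omega) (by omega)
      have := hle (u := u) (by omega) (by omega)
      omega
    · exact hm (by omega) (by omega)
    · exact hm (by omega) (by omega)
  have hBC : (C.filter fun u => ¬ π u < a).card = (B.filter (π · < 0)).card := by
    refine IsPlanarInvolution.card_eq_card (π := π) ?_ ?_ ?_ ?_ <;> intro u hu <;>
      simp only [B, C, Finset.mem_filter, Finset.mem_Ico] at hu ⊢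
    · have := hm (u := u) (by omega) (by omega)
      have := hlt (u := u) (by omega) (by omega)
      omega
    · have := hm (u := u) (by omega) (by omega)
      have := hle (u := u) (by omega) (by omega)
      omega
    · exact hm (by omega) (by omega)
    · exact hm (by omega) (by omega)
  have hAB : (B.filter fun u => ¬ π u < 0).card = (A.filter fun u => ¬ π u < 0).card := by
    refine IsPlanarInvolution.card_eq_card (π := π) ?_ ?_ ?_ ?_ <;> intro u hu <;>
      simp only [A, B, Finset.mem_filter, Finset.mem_Ico] at hu ⊢
    · have := hm (u := u) (by omega) (by omega)
      have := h.right (u := u) (by omega) (by omega)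
      omega
    · have := hm (u := u) (by omega) (by omega)
      have := hlt (u := u) (by omega) (by omega)
      have := h.left (u := u) (by omega) (by omega)
      omega
    · exact hm (by omega) (by omega)
    · exact hm (by omega) (by omega)
  generalize hx : (A.filter fun u => ¬ π u < 0).card = x at *
  generalize hy : (A.filter (π · < 0)).card = y at *
  generalize (B.filter (π · < 0)).card = z at *
  -- the points of the left block that are joined to the top one are the first `y` points
  have h₁ : ∀ u : ℤ, 0 ≤ u → u < a → π u < 0 → u < y := by
    intro u h₀ h₁ h₂
    have e := hm (u := u) (by omega) (by omega)
    have := Finset.card_le_card (s := Finset.Ico 0 (u + 1)) (t := A.filter (π · < 0))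
      fun v hv => by
        simp only [A, Finset.mem_filter, Finset.mem_Ico] at hv ⊢
        rcases eq_or_ne v u with rfl | hvu
        · omega
        have := h.planar.nested (u := π u) (v := v) (hle (by omega) (by omega))
          (by omega) (by omega) (by omega)
        have := h.left (u := v) (by omega) (by omega)
        omega
    rw [Int.card_Ico, hy] at this
    omega
  have h₂ : ∀ u : ℤ, 0 ≤ u → u < a → a ≤ π u → y ≤ u := by
    intro u h₀ h₁ h₂
    have := Finset.card_le_card (s := Finset.Ico u a) (t := A.filter fun u => ¬ π u < 0)
      fun v hv => by
        simp only [A, Finset.mem_filter, Finset.mem_Ico] at hv ⊢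
        rcases eq_or_ne v u with rfl | hvu
        · omega
        have := h.planar.nested (u := u) (v := v) (by omega) (hlt (by omega) (by omega))
          (by omega) (by omega)
        omega
    rw [Int.card_Ico, hx] at this
    omega
  -- so `π` is known on the left block, and thereby on all the points joined to it
  have hA₁ : ∀ u : ℤ, 0 ≤ u → u < y → π u = -1 - u := by
    intro u h₃ h₄
    have h₅ := h.left (u := u) (by omega) (by omega)
    have h₆ := h₂ u (by omega) (by omega)
    have h₇ := h.add_map_of_top_left (u := π u) (hle (by omega) (by omega)) (by omega)
      (by rw [hm (by omega) (by omega)]; omega)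
    rw [hm (by omega) (by omega)] at h₇
    omega
  have hA₂ : ∀ u : ℤ, y ≤ u → u < a → π u = 2 * a - 1 - u := by
    intro u h₃ h₄
    have h₅ := h.left (u := u) (by omega) (by omega)
    have h₆ := h₁ u (by omega) (by omega)
    have h₇ := h.add_map_of_left_right (u := u) (by omega) (by omega) (by omega)
    omega
  refine ⟨x, y, z, by omega, by omega, by omega, fun u hu hu' => ?_⟩
  unfold triadMap
  have hl := hle hu hu'
  have hr := hlt hu hu'
  have hmu := hm hu hu'
  split_ifs with c₁ c₂ c₃
  · have k₁ := h.top hu (by omega)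
    have k₂ := fun k => h.add_map_of_top_left hu (by omega) k
    have k₃ := fun k => h.add_map_of_top_right hu (by omega) k
    have k₄ := fun k₁ k₂ => hA₁ (π u) k₁ k₂
    have k₅ := fun k₁ k₂ => hA₂ (π u) k₁ k₂
    by_cases k₆ : π u < a
    · by_cases k₇ : π u < y <;> omega
    · omega
  · by_cases k : 0 ≤ u
    · exact hA₁ u k c₂
    · have k₁ := hA₁ (-1 - u) (by omega) (by omega)
      rw [show -1 - (-1 - u) = u by ring] at k₁
      rw [← k₁, hm (by omega) (by omega)]
      omega
  · by_cases k : u < a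
    · rw [hA₂ u (by omega) k]
      omega
    · have k₁ := hA₂ (2 * a - 1 - u) (by omega) (by omega)
      rw [show 2 * (a : ℤ) - 1 - (2 * a - 1 - u) = u by ring] at k₁
      nth_rewrite 1 [← k₁]
      rw [hm (by omega) (by omega)]
      omega
  · have k₁ := h.right (u := u) (by omega) (by omega)
    have k₄ := fun k₁ k₂ => hA₁ (π u) k₁ k₂
    have k₅ := fun k₁ k₂ => hA₂ (π u) k₁ k₂
    by_cases k₆ : 0 ≤ π u
    · by_cases k₇ : π u < y <;> omega
    · have k₃ := h.add_map_of_top_right (u := π u) hl (by omega) (by omega)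
      omega

/-! ### Diagrams without arcs inside a block -/

variable {m n k : ℕ}

/-- Every diagram comes from a planar involution. -/
theorem exists_involution (f : Diagram m n) : ∃ π : ℤ → ℤ, ∃ h : IsPlanarInvolution (-n) m π,
    f = ofInvolution π h := by
  choose p hp hp' using fun x => (f.pairing x)
  have key : ∀ u : ℤ, ∃ v : ℤ, ∀ x : Fin m ⊕ Fin n, circlePos x = u → circlePos (p x) = v := by
    intro u
    by_cases hu : ∃ x : Fin m ⊕ Fin n, circlePos x = u
    · obtain ⟨x, hx⟩ := hu
      exact ⟨circlePos (p x), fun y hy => by rw [circlePos_injective (hy.trans hx.symm)]⟩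
    · exact ⟨0, fun x hx => absurd ⟨x, hx⟩ hu⟩
  choose π hπ using key
  replace hπ : ∀ x, π (circlePos x) = circlePos (p x) := fun x => (hπ _ x rfl).symm
  have hpp : ∀ x, p (p x) = x := fun x => (hp' (p x) x ⟨(hp x).1.symm, f.rel.symm (hp x).2⟩).symm
  have h : IsPlanarInvolution (-n) m π := by
    refine ⟨?_, ?_, ?_, ?_, ?_⟩
    · rintro u h₁ h₂
      obtain ⟨x, rfl⟩ := exists_circlePos_eq (m := m) (n := n) h₁ h₂
      rw [hπ]
      exact (circlePos_mem _).1
    · rintro u h₁ h₂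
      obtain ⟨x, rfl⟩ := exists_circlePos_eq (m := m) (n := n) h₁ h₂
      rw [hπ]
      exact (circlePos_mem _).2
    · rintro u h₁ h₂
      obtain ⟨x, rfl⟩ := exists_circlePos_eq (m := m) (n := n) h₁ h₂
      rw [hπ]
      exact fun e => (hp x).1 (circlePos_injective e)
    · rintro u h₁ h₂
      obtain ⟨x, rfl⟩ := exists_circlePos_eq (m := m) (n := n) h₁ h₂
      rw [hπ, hπ, hpp]
    · rintro u v h₁ h₂ huv hv
      obtain ⟨x, rfl⟩ := exists_circlePos_eq (m := m) (n := n) h₁ (huv.trans h₂)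
      obtain ⟨y, rfl⟩ := exists_circlePos_eq (m := m) (n := n) (h₁.trans huv.le) h₂
      rw [hπ] at hv ⊢
      rw [hπ]
      by_contra hlt
      exact f.noncrossing _ _ _ _ huv hv (not_le.1 hlt) (hp x).2 (hp y).2
  refine ⟨π, h, (ext_of_le ?_).symm⟩
  rintro x y (e | e)
  · rw [circlePos_injective e]
  · rw [hπ] at e
    rw [circlePos_injective e]
    exact (hp x).2

/-- Two of the points of the boundary circle at the positions `u` with `l ≤ u < r` are joined. -/
def HasArcIn (f : Diagram m n) (l r : ℤ) : Prop :=
  ∃ x y, x ≠ y ∧ f.rel x y ∧ l ≤ circlePos x ∧ circlePos x < r ∧ l ≤ circlePos y ∧ circlePos y < r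

theorem HasArcIn.mono {f : Diagram m n} {l r l' r' : ℤ} (h : f.HasArcIn l r) (hl : l' ≤ l)
    (hr : r ≤ r') : f.HasArcIn l' r' := by
  obtain ⟨x, y, hxy, h₀, h₁, h₂, h₃, h₄⟩ := h
  exact ⟨x, y, hxy, h₀, by omega, by omega, by omega, by omega⟩

theorem hasArcIn_ofInvolution {π : ℤ → ℤ} {h : IsPlanarInvolution (-n) m π} {l r : ℤ} :
    (ofInvolution π h).HasArcIn l r ↔
      ∃ u, -(n : ℤ) ≤ u ∧ u < m ∧ l ≤ u ∧ u < r ∧ l ≤ π u ∧ π u < r := by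
  constructor
  · rintro ⟨x, y, hxy, h₀ | h₀, h₁, h₂, h₃, h₄⟩
    · exact absurd (circlePos_injective h₀).symm hxy
    · exact ⟨circlePos x, (circlePos_mem x).1, (circlePos_mem x).2, h₁, h₂, h₀ ▸ h₃, h₀ ▸ h₄⟩
  · rintro ⟨u, hu, hu', h₁, h₂, h₃, h₄⟩
    obtain ⟨x, rfl⟩ := exists_circlePos_eq (m := m) (n := n) hu hu'
    obtain ⟨y, hy⟩ := exists_circlePos_eq (m := m) (n := n) (h.le_map hu hu') (h.map_lt hu hu')
    refine ⟨x, y, ?_, Or.inr hy, h₁, h₂, hy ▸ h₃, hy ▸ h₄⟩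
    rintro rfl
    exact h.map_ne hu hu' hy.symm

/-- If there is an arc in some range, then there is one in it that joins two neighbours. -/
theorem HasArcIn.exists_adjacent {f : Diagram m n} {l r : ℤ} (h : f.HasArcIn l r) :
    ∃ u, l ≤ u ∧ u + 1 < r ∧ -(n : ℤ) ≤ u ∧ u + 1 < m ∧
      ∀ x y, circlePos x = u → circlePos y = u + 1 → f.rel x y := by
  obtain ⟨π, hπ, rfl⟩ := f.exists_involution
  obtain ⟨u, hu, hu', h₁, h₂, h₃, h₄⟩ := hasArcIn_ofInvolution.1 h
  have hl := hπ.le_map hu hu'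
  have hr := hπ.map_lt hu hu'
  have hne := hπ.map_ne hu hu'
  have hm := hπ.map_map hu hu'
  obtain ⟨w, hw⟩ : ∃ w, l ≤ w ∧ w + 1 < r ∧ -(n : ℤ) ≤ w ∧ w + 1 < m ∧ π w = w + 1 := by
    rcases lt_or_gt_of_ne hne with h₅ | h₅
    · obtain ⟨w, k₁, k₂, k₃⟩ := hπ.exists_adjacent (u := π u) hl (by omega) (by omega)
      exact ⟨w, by omega, by omega, by omega, by omega, k₃⟩
    · obtain ⟨w, k₁, k₂, k₃⟩ := hπ.exists_adjacent hu hr h₅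
      exact ⟨w, by omega, by omega, by omega, by omega, k₃⟩
  refine ⟨w, hw.1, hw.2.1, hw.2.2.1, hw.2.2.2.1, fun x y hx hy => Or.inr ?_⟩
  rw [hx, hy, hw.2.2.2.2]

/-- The top points, the first `a` bottom points and the last `b` bottom points form blocks inside
which no two points are joined. -/
def IsSplit {a b c : ℕ} (f : Diagram (a + b) c) : Prop :=
  ¬ f.HasArcIn (-c) 0 ∧ ¬ f.HasArcIn 0 a ∧ ¬ f.HasArcIn a (a + b : ℕ)

variable {a b c : ℕ}

theorem isSplit_ofInvolution {π : ℤ → ℤ} {h : IsPlanarInvolution (-c) (a + b : ℕ) π} :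
    (ofInvolution π h).IsSplit ↔ IsTriad a b c π := by
  rw [IsSplit, hasArcIn_ofInvolution, hasArcIn_ofInvolution, hasArcIn_ofInvolution]
  constructor
  · rintro ⟨h₁, h₂, h₃⟩
    refine ⟨h, fun {u} hu hu' => ?_, fun {u} hu hu' => ?_, fun {u} hu hu' => ?_⟩
    · by_contra hc
      exact h₁ ⟨u, by omega, by omega, hu, hu', h.le_map (by omega) (by omega), by omega⟩
    · by_contra hc
      exact h₂ ⟨u, by omega, by omega, hu, hu', by omega, by omega⟩
    · by_contra hc
      exact h₃ ⟨u, by omega, by omega, hu, hu', by omega, h.map_lt (by omega) (by omega)⟩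
  · intro ht
    refine ⟨?_, ?_, ?_⟩ <;> rintro ⟨u, h₁, h₂, h₃, h₄, h₅, h₆⟩
    · have := ht.top h₃ h₄
      omega
    · have := ht.left h₃ h₄
      omega
    · have := ht.right h₃ h₄
      omega

theorem IsSplit.admissible {f : Diagram (a + b) c} (hf : f.IsSplit) : Admissible a b c := by
  obtain ⟨π, h, rfl⟩ := f.exists_involution
  obtain ⟨x, y, z, rfl, rfl, rfl, -⟩ := (isSplit_ofInvolution.1 hf).eq_triadMap
  exact ⟨⟨x + y + z, by omega⟩, by omega, by omega, by omega⟩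

theorem IsSplit.eq {f g : Diagram (a + b) c} (hf : f.IsSplit) (hg : g.IsSplit) : f = g := by
  obtain ⟨π, h, rfl⟩ := f.exists_involution
  obtain ⟨π', h', rfl⟩ := g.exists_involution
  obtain ⟨x, y, z, ha, hb, hc, e⟩ := (isSplit_ofInvolution.1 hf).eq_triadMap
  obtain ⟨x', y', z', ha', hb', hc', e'⟩ := (isSplit_ofInvolution.1 hg).eq_triadMap
  obtain rfl : x = x' := by omega
  obtain rfl : y = y' := by omega
  refine ext_of_le ?_
  rintro u v (huv | huv)
  · exact Or.inl huv
  · refine Or.inr ?_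
    rw [huv, e _ (circlePos_mem u).1 (circlePos_mem u).2,
      e' _ (circlePos_mem u).1 (circlePos_mem u).2]

theorem exists_isSplit (h : Admissible a b c) : ∃ f : Diagram (a + b) c, f.IsSplit := by
  obtain ⟨⟨s, hs⟩, h₁, h₂, h₃⟩ := h
  obtain ⟨x, y, z, rfl, rfl, rfl⟩ : ∃ x y z, a = x + y ∧ b = x + z ∧ c = y + z :=
    ⟨s - c, s - b, s - a, by omega, by omega, by omega⟩
  exact ⟨ofInvolution _ (isTriad_triadMap x y z).planar,
    isSplit_ofInvolution.2 (isTriad_triadMap x y z)⟩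

theorem circlePos_eq_inl {x : Fin m ⊕ Fin n} (h : 0 ≤ circlePos x) :
    ∃ i : Fin m, x = Sum.inl i := by
  rcases x with x | x
  · exact ⟨x, rfl⟩
  · simp only [circlePos] at h
    omega

theorem circlePos_eq_inr {x : Fin m ⊕ Fin n} (h : circlePos x < 0) :
    ∃ i : Fin n, x = Sum.inr i := by
  rcases x with x | x
  · simp only [circlePos] at h
    omega
  · exact ⟨x, rfl⟩

theorem HasArcIn.comp {f : Diagram m n} {l r : ℤ} (h : f.HasArcIn l r) (hl : 0 ≤ l)
    (g : Diagram n k) : (f.comp g).HasArcIn l r := by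
  obtain ⟨x, y, hxy, h₀, h₁, h₂, h₃, h₄⟩ := h
  obtain ⟨x, rfl⟩ := circlePos_eq_inl (hl.trans h₁)
  obtain ⟨y, rfl⟩ := circlePos_eq_inl (hl.trans h₃)
  exact ⟨Sum.inl x, Sum.inl y, fun e => hxy (by rw [Sum.inl_injective e]),
    comp_rel_bottom h₀ g, h₁, h₂, h₃, h₄⟩

theorem HasArcIn.comp_left {g : Diagram n k} {l r : ℤ} (h : g.HasArcIn l r) (hr : r ≤ 0)
    (f : Diagram m n) : (f.comp g).HasArcIn l r := by
  obtain ⟨x, y, hxy, h₀, h₁, h₂, h₃, h₄⟩ := h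
  obtain ⟨x, rfl⟩ := circlePos_eq_inr (h₂.trans_le hr)
  obtain ⟨y, rfl⟩ := circlePos_eq_inr (h₄.trans_le hr)
  exact ⟨Sum.inr x, Sum.inr y, fun e => hxy (by rw [Sum.inr_injective e]),
    comp_rel_top f h₀, h₁, h₂, h₃, h₄⟩

theorem HasArcIn.juxtapose {f : Diagram m n} {l r : ℤ} (h : f.HasArcIn l r) {m' n' : ℕ}
    (g : Diagram m' n') : (f.juxtapose g).HasArcIn l r := by
  have e : ∀ x : Fin m ⊕ Fin n,
      circlePos (Sum.map (Fin.castAdd m') (Fin.castAdd n') x) = circlePos x := by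
    rintro (x | x) <;> rfl
  obtain ⟨x, y, hxy, h₀, h₁, h₂, h₃, h₄⟩ := h
  refine ⟨_, _, fun h => hxy (circlePos_injective ?_), juxtapose_rel_left h₀ g, ?_⟩
  · rw [← e, h, e]
  · rw [e, e]
    exact ⟨h₁, h₂, h₃, h₄⟩

theorem HasArcIn.juxtapose_left {g : Diagram m n} {l r : ℤ} (h : g.HasArcIn l r) (hl : 0 ≤ l)
    {m' n' : ℕ} (f : Diagram m' n') : (f.juxtapose g).HasArcIn (m' + l) (m' + r) := by
  obtain ⟨x, y, hxy, h₀, h₁, h₂, h₃, h₄⟩ := h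
  obtain ⟨x, rfl⟩ := circlePos_eq_inl (hl.trans h₁)
  obtain ⟨y, rfl⟩ := circlePos_eq_inl (hl.trans h₃)
  refine ⟨_, _, fun h => hxy ?_, juxtapose_rel_right f h₀, ?_⟩
  · simpa using h
  · simp only [circlePos, Sum.map_inl, Fin.val_natAdd, Nat.cast_add] at *
    omega

end Diagram

/-! ### Combinations of diagrams with an arc in a given range -/

namespace TL

open Diagram

/-- The span of the diagrams that join two of the points of the boundary circle at the positions
`u` with `l ≤ u < r`. -/
noncomputable def arcSpan (m n : ℕ) (l r : ℤ) : Submodule GroundField ((⟨m⟩ : TL) ⟶ ⟨n⟩) :=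
  Submodule.span GroundField {f | ∃ D : Diagram m n, D.HasArcIn l r ∧ ofDiagram D = f}

section arcSpan

variable {m n k m' n' : ℕ} {l r : ℤ}

theorem ofDiagram_mem_arcSpan {D : Diagram m n} (h : D.HasArcIn l r) :
    ofDiagram D ∈ arcSpan m n l r := Submodule.subset_span ⟨D, h, rfl⟩

/-- To map `arcSpan m n l r` into a subspace, a linear map only has to do so on diagrams. -/
theorem map_mem_of_mem_arcSpan {x y : TL} (φ : ((⟨m⟩ : TL) ⟶ ⟨n⟩) →ₗ[GroundField] (x ⟶ y))
    {S : Submodule GroundField (x ⟶ y)} (h : ∀ D : Diagram m n, D.HasArcIn l r →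
      φ (ofDiagram D) ∈ S) {f : (⟨m⟩ : TL) ⟶ ⟨n⟩} (hf : f ∈ arcSpan m n l r) : φ f ∈ S := by
  have : arcSpan m n l r ≤ S.comap φ := by
    refine Submodule.span_le.2 ?_
    rintro _ ⟨D, hD, rfl⟩
    exact h D hD
  exact this hf

theorem arcSpan_mono {l' r' : ℤ} (hl : l' ≤ l) (hr : r ≤ r') :
    arcSpan m n l r ≤ arcSpan m n l' r' :=
  fun _ => map_mem_of_mem_arcSpan LinearMap.id fun _ hD => ofDiagram_mem_arcSpan (hD.mono hl hr)

theorem comp_mem_arcSpan {f : (⟨m⟩ : TL) ⟶ ⟨n⟩} (hf : f ∈ arcSpan m n l r) (hl : 0 ≤ l)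
    (g : (⟨n⟩ : TL) ⟶ ⟨k⟩) : f ≫ g ∈ arcSpan m k l r := by
  refine map_mem_of_mem_arcSpan (Linear.rightComp GroundField _ g) (fun D hD => ?_) hf
  change ofDiagram D ≫ g ∈ _
  induction g using hom_induction with
  | zero => rw [Limits.comp_zero]; exact zero_mem _
  | add g g' h h' => rw [Preadditive.comp_add]; exact add_mem h h'
  | smul c g h => rw [Linear.comp_smul]; exact Submodule.smul_mem _ c h
  | diagram E =>
    rw [ofDiagram_comp]
    exact Submodule.smul_mem _ _ (ofDiagram_mem_arcSpan (hD.comp hl E))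

theorem comp_mem_arcSpan_left {g : (⟨n⟩ : TL) ⟶ ⟨k⟩} (hg : g ∈ arcSpan n k l r) (hr : r ≤ 0)
    (f : (⟨m⟩ : TL) ⟶ ⟨n⟩) : f ≫ g ∈ arcSpan m k l r := by
  refine map_mem_of_mem_arcSpan (Linear.leftComp GroundField _ f) (fun D hD => ?_) hg
  change f ≫ ofDiagram D ∈ _
  induction f using hom_induction with
  | zero => rw [Limits.zero_comp]; exact zero_mem _
  | add f f' h h' => rw [Preadditive.add_comp]; exact add_mem h h'
  | smul c f h => rw [Linear.smul_comp]; exact Submodule.smul_mem _ c h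
  | diagram E =>
    rw [ofDiagram_comp]
    exact Submodule.smul_mem _ _ (ofDiagram_mem_arcSpan (hD.comp_left hr E))

theorem tensorHom_mem_arcSpan {f : (⟨m⟩ : TL) ⟶ ⟨n⟩} (hf : f ∈ arcSpan m n l r)
    (g : (⟨m'⟩ : TL) ⟶ ⟨n'⟩) : tensorHom f g ∈ arcSpan (m + m') (n + n') l r := by
  refine map_mem_of_mem_arcSpan ((FormalDiagram.juxtapose m n m' n').flip g :
    ((⟨m⟩ : TL) ⟶ ⟨n⟩) →ₗ[GroundField] ((⟨m + m'⟩ : TL) ⟶ ⟨n + n'⟩)) (fun D hD => ?_) hf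
  change tensorHom (ofDiagram D) g ∈ _
  induction g using hom_induction with
  | zero => rw [tensorHom_zero]; exact zero_mem _
  | add g g' h h' => rw [tensorHom_add]; exact add_mem h h'
  | smul c g h => rw [tensorHom_smul]; exact Submodule.smul_mem _ c h
  | diagram E =>
    rw [tensorHom_ofDiagram]
    exact ofDiagram_mem_arcSpan (hD.juxtapose E)

theorem tensorHom_mem_arcSpan_left {g : (⟨m⟩ : TL) ⟶ ⟨n⟩} (hg : g ∈ arcSpan m n l r)
    (hl : 0 ≤ l) (f : (⟨m'⟩ : TL) ⟶ ⟨n'⟩) :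
    tensorHom f g ∈ arcSpan (m' + m) (n' + n) (m' + l) (m' + r) := by
  refine map_mem_of_mem_arcSpan (FormalDiagram.juxtapose m' n' m n f :
    ((⟨m⟩ : TL) ⟶ ⟨n⟩) →ₗ[GroundField] ((⟨m' + m⟩ : TL) ⟶ ⟨n' + n⟩)) (fun D hD => ?_) hg
  change tensorHom f (ofDiagram D) ∈ _
  induction f using hom_induction with
  | zero => rw [zero_tensorHom]; exact zero_mem _
  | add f f' h h' => rw [add_tensorHom]; exact add_mem h h'
  | smul c f h => rw [smul_tensorHom]; exact Submodule.smul_mem _ c h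
  | diagram E =>
    rw [tensorHom_ofDiagram]
    exact ofDiagram_mem_arcSpan (hD.juxtapose_left hl E)

theorem strand_mem_arcSpan {f : (⟨n⟩ : TL) ⟶ ⟨n⟩} (hf : f ∈ arcSpan n n l r) :
    strand f ∈ arcSpan (n + 1) (n + 1) l r := tensorHom_mem_arcSpan hf _

end arcSpan

theorem hook_mem_arcSpan_bottom (n : ℕ) : hook n ∈ arcSpan (n + 2) (n + 2) 0 (n + 2 : ℕ) := by
  rw [hook_eq]
  refine ofDiagram_mem_arcSpan ⟨Sum.inl ⟨n, by omega⟩, Sum.inl ⟨n + 1, by omega⟩, ?_,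
    hookAt_bottom rfl rfl, ?_⟩
  · simp
  · simp only [circlePos]
    omega

theorem hook_mem_arcSpan_top (n : ℕ) : hook n ∈ arcSpan (n + 2) (n + 2) (-(n + 2 : ℕ)) 0 := by
  rw [hook_eq]
  refine ofDiagram_mem_arcSpan ⟨Sum.inr ⟨n, by omega⟩, Sum.inr ⟨n + 1, by omega⟩, ?_,
    hookAt_top rfl rfl, ?_⟩
  · simp
  · simp only [circlePos]
    omega

/-- The identity appears in `p n` with coefficient `1`, and the other diagrams that appear in it
join two bottom points. -/
theorem jonesWenzl_sub_id_mem_arcSpan_bottom (n : ℕ) : jonesWenzl n - 𝟙 _ ∈ arcSpan n n 0 n := by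
  induction n using jonesWenzl.induct with
  | case1 => exact (sub_self (𝟙 (⟨0⟩ : TL))) ▸ zero_mem _
  | case2 => exact (sub_self (𝟙 (⟨1⟩ : TL))) ▸ zero_mem _
  | case3 n ih =>
    have h₁ := arcSpan_mono le_rfl (show ((n + 1 : ℕ) : ℤ) ≤ (n + 2 : ℕ) by omega)
      (strand_mem_arcSpan ih)
    rw [strand_sub, strand_id] at h₁
    have h₂ : strand (jonesWenzl (n + 1)) ≫ hook n ∈ arcSpan (n + 2) (n + 2) 0 (n + 2 : ℕ) := by
      have := add_mem (comp_mem_arcSpan h₁ le_rfl (hook n)) (hook_mem_arcSpan_bottom n)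
      rwa [Preadditive.sub_comp, Category.id_comp, sub_add_cancel] at this
    rw [jonesWenzl_add_two, sub_right_comm, ← Category.assoc]
    exact sub_mem h₁ (Submodule.smul_mem _ _ (comp_mem_arcSpan h₂ le_rfl _))

theorem jonesWenzl_sub_id_mem_arcSpan_top (n : ℕ) :
    jonesWenzl n - 𝟙 _ ∈ arcSpan n n (-n) 0 := by
  induction n using jonesWenzl.induct with
  | case1 => exact (sub_self (𝟙 (⟨0⟩ : TL))) ▸ zero_mem _
  | case2 => exact (sub_self (𝟙 (⟨1⟩ : TL))) ▸ zero_mem _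
  | case3 n ih =>
    have h₁ := arcSpan_mono (show -((n + 2 : ℕ) : ℤ) ≤ -(n + 1 : ℕ) by omega) le_rfl
      (strand_mem_arcSpan ih)
    rw [strand_sub, strand_id] at h₁
    have h₂ : hook n ≫ strand (jonesWenzl (n + 1)) ∈
        arcSpan (n + 2) (n + 2) (-(n + 2 : ℕ)) 0 := by
      have := add_mem (comp_mem_arcSpan_left h₁ le_rfl (hook n)) (hook_mem_arcSpan_top n)
      rwa [Preadditive.comp_sub, Category.comp_id, sub_add_cancel] at this
    rw [jonesWenzl_add_two, sub_right_comm]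
    exact sub_mem h₁ (Submodule.smul_mem _ _ (comp_mem_arcSpan_left h₂ le_rfl _))

/-! ### The projection onto a morphism space of the Karoubi envelope -/

section Projection

variable {m n : ℕ} {a b c : ℕ}

/-- As `d ≠ 0`, a morphism that annihilates a hook annihilates every diagram that absorbs it. -/
theorem comp_ofDiagram_eq_zero {x : TL} {i : ℕ} {hi : i + 1 < m} {p : x ⟶ ⟨m⟩}
    (hp : p ≫ ofDiagram (hookAt m i hi) = 0) {D : Diagram m n}
    (hD : ∀ j k : Fin m, (j : ℕ) = i → (k : ℕ) = i + 1 → D.rel (Sum.inl j) (Sum.inl k)) :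
    p ≫ ofDiagram D = 0 := by
  have h := ofDiagram_comp (hookAt m i hi) D
  rw [hookAt_comp hD] at h
  have h' := congrArg (p ≫ ·) h
  simp only [← Category.assoc, hp, Limits.zero_comp, Linear.comp_smul] at h'
  exact (smul_eq_zero.1 h'.symm).resolve_left (pow_ne_zero _ loopValue_ne_zero)

theorem ofDiagram_comp_eq_zero {x : TL} {i : ℕ} {hi : i + 1 < n} {p : ⟨n⟩ ⟶ x}
    (hp : ofDiagram (hookAt n i hi) ≫ p = 0) {D : Diagram m n}
    (hD : ∀ j k : Fin n, (j : ℕ) = i → (k : ℕ) = i + 1 → D.rel (Sum.inr j) (Sum.inr k)) :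
    ofDiagram D ≫ p = 0 := by
  have h := ofDiagram_comp D (hookAt n i hi)
  rw [comp_hookAt hD] at h
  have h' := congrArg (· ≫ p) h
  simp only [Category.assoc, hp, Limits.comp_zero, Linear.smul_comp] at h'
  exact (smul_eq_zero.1 h'.symm).resolve_left (pow_ne_zero _ loopValue_ne_zero)

/-- The idempotent `p a ⊗ p b`. -/
noncomputable def jonesWenzlTensor (a b : ℕ) : (⟨a + b⟩ : TL) ⟶ ⟨a + b⟩ :=
  tensorHom (jonesWenzl a) (jonesWenzl b)

theorem jonesWenzlTensor_comp_hookAt {i : ℕ} (hi : i + 1 < a + b) (h : i + 1 ≠ a) :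
    jonesWenzlTensor a b ≫ ofDiagram (hookAt (a + b) i hi) = 0 := by
  rcases lt_or_ge (i + 1) a with h' | h'
  · rw [← hookAt_juxtapose_one h', ← tensorHom_ofDiagram]
    refine (tensorHom_comp _ _ _ _).trans ?_
    rw [jonesWenzl_comp_hookAt, zero_tensorHom]
  · obtain ⟨j, rfl⟩ : ∃ j, i = a + j := ⟨i - a, by omega⟩
    rw [← one_juxtapose_hookAt (N := b) (by omega), ← tensorHom_ofDiagram]
    refine (tensorHom_comp _ _ _ _).trans ?_
    rw [jonesWenzl_comp_hookAt, tensorHom_zero]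

theorem jonesWenzlTensor_comp_ofDiagram {D : Diagram (a + b) n}
    (hD : D.HasArcIn 0 a ∨ D.HasArcIn a (a + b : ℕ)) :
    jonesWenzlTensor a b ≫ ofDiagram D = 0 := by
  obtain ⟨i, hi, hia, h⟩ : ∃ i : ℕ, i + 1 < a + b ∧ i + 1 ≠ a ∧
      ∀ x y, circlePos x = i → circlePos y = i + 1 → D.rel x y := by
    rcases hD with hD | hD
    all_goals
      obtain ⟨u, h₁, h₂, h₃, h₄, h⟩ := hD.exists_adjacent
      obtain ⟨i, rfl⟩ := Int.eq_ofNat_of_zero_le (a := u) (by omega)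
      exact ⟨i, by omega, by omega, h⟩
  refine comp_ofDiagram_eq_zero (jonesWenzlTensor_comp_hookAt hi hia)
    fun j k hj hk => h _ _ ?_ ?_
  · simp only [circlePos, hj]
  · simp only [circlePos, hk, Nat.cast_add, Nat.cast_one]

theorem ofDiagram_comp_jonesWenzl {D : Diagram m n} (hD : D.HasArcIn (-n) 0) :
    ofDiagram D ≫ jonesWenzl n = 0 := by
  obtain ⟨u, h₁, h₂, -, -, h⟩ := hD.exists_adjacent
  obtain ⟨i, rfl⟩ : ∃ i : ℕ, u = -i - 2 := ⟨(-u - 2).toNat, by omega⟩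
  refine ofDiagram_comp_eq_zero (hookAt_comp_jonesWenzl (show i + 1 < n by omega))
    fun j k hj hk => D.rel.symm (h _ _ ?_ ?_)
  · simp only [circlePos, hk]
    omega
  · simp only [circlePos, hj]
    omega

/-- Composition with `p a ⊗ p b` on the bottom and with `p c` on the top. -/
noncomputable def project (a b c : ℕ) :
    ((⟨a + b⟩ : TL) ⟶ ⟨c⟩) →ₗ[GroundField] ((⟨a + b⟩ : TL) ⟶ ⟨c⟩) :=
  Linear.leftComp GroundField _ (jonesWenzlTensor a b) ∘ₗ
    Linear.rightComp GroundField _ (jonesWenzl c)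

theorem project_apply (f : (⟨a + b⟩ : TL) ⟶ ⟨c⟩) :
    project a b c f = jonesWenzlTensor a b ≫ f ≫ jonesWenzl c := rfl

theorem project_ofDiagram_of_not_isSplit {D : Diagram (a + b) c} (hD : ¬ D.IsSplit) :
    project a b c (ofDiagram D) = 0 := by
  rw [project_apply]
  by_cases h : D.HasArcIn (-c) 0
  · rw [ofDiagram_comp_jonesWenzl h, Limits.comp_zero]
  · rw [← Category.assoc, jonesWenzlTensor_comp_ofDiagram, Limits.zero_comp]
    simp only [IsSplit] at hD
    tauto

/-- The combinations of diagrams that do not contain the diagram `D`. -/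
noncomputable def coeffKer (D : Diagram m n) : Submodule GroundField ((⟨m⟩ : TL) ⟶ ⟨n⟩) :=
  LinearMap.ker (Finsupp.lapply D : FormalDiagram m n →ₗ[GroundField] GroundField)

theorem arcSpan_le_coeffKer {l r : ℤ} {D : Diagram m n} (hD : ¬ D.HasArcIn l r) :
    arcSpan m n l r ≤ coeffKer D := by
  refine Submodule.span_le.2 ?_
  rintro _ ⟨E, hE, rfl⟩
  refine Finsupp.single_eq_of_ne ?_
  rintro rfl
  exact hD hE

/-- The projection does not change the coefficient of a split diagram: all the diagrams but the
identity in the Jones-Wenzl idempotents produce an arc inside one of the blocks. -/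
theorem project_sub_mem_coeffKer {D : Diagram (a + b) c} (hD : D.IsSplit)
    (f : (⟨a + b⟩ : TL) ⟶ ⟨c⟩) : project a b c f - f ∈ coeffKer D := by
  obtain ⟨h₁, h₂, h₃⟩ := hD
  have e : jonesWenzlTensor a b - 𝟙 _ =
      (tensorHom (jonesWenzl a - 𝟙 _) (jonesWenzl b) : (⟨a + b⟩ : TL) ⟶ ⟨a + b⟩) +
      (tensorHom (𝟙 (⟨a⟩ : TL)) (jonesWenzl b - 𝟙 _) : (⟨a + b⟩ : TL) ⟶ ⟨a + b⟩) := by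
    have h : (𝟙 _ : (⟨a + b⟩ : TL) ⟶ ⟨a + b⟩) = tensorHom (𝟙 (⟨a⟩ : TL)) (𝟙 (⟨b⟩ : TL)) := by
      rw [id_eq_ofDiagram a, id_eq_ofDiagram b, tensorHom_ofDiagram, one_juxtapose_one]
      rfl
    rw [sub_tensorHom, tensorHom_sub, jonesWenzlTensor, h]
    exact (sub_add_sub_cancel _ _ _).symm
  have k₁ := comp_mem_arcSpan (tensorHom_mem_arcSpan (jonesWenzl_sub_id_mem_arcSpan_bottom a)
    (jonesWenzl b)) le_rfl (f ≫ jonesWenzl c)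
  have k₂ := comp_mem_arcSpan (tensorHom_mem_arcSpan_left (jonesWenzl_sub_id_mem_arcSpan_bottom b)
    le_rfl (𝟙 (⟨a⟩ : TL))) (by omega) (f ≫ jonesWenzl c)
  have k₃ := comp_mem_arcSpan_left (jonesWenzl_sub_id_mem_arcSpan_top c) le_rfl f
  rw [add_zero, ← Nat.cast_add] at k₂
  have k := add_mem (add_mem (arcSpan_le_coeffKer h₂ k₁) (arcSpan_le_coeffKer h₃ k₂))
    (arcSpan_le_coeffKer h₁ k₃)
  rw [← Preadditive.add_comp, ← e, Preadditive.sub_comp, Preadditive.comp_sub, Category.id_comp,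
    Category.comp_id, sub_add_sub_cancel] at k
  exact k

theorem project_ofDiagram_ne_zero {D : Diagram (a + b) c} (hD : D.IsSplit) :
    project a b c (ofDiagram D) ≠ 0 := by
  intro h
  have := project_sub_mem_coeffKer hD (ofDiagram D)
  rw [h, zero_sub, neg_mem_iff] at this
  have h' : (Finsupp.single D (1 : GroundField)) D = 0 := this
  rw [Finsupp.single_eq_same] at h'
  exact one_ne_zero h'

theorem project_project (f : (⟨a + b⟩ : TL) ⟶ ⟨c⟩) :
    project a b c (project a b c f) = project a b c f := by
  have h : jonesWenzlTensor a b ≫ jonesWenzlTensor a b = jonesWenzlTensor a b := by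
    refine (tensorHom_comp _ _ _ _).trans ?_
    rw [jonesWenzl_idem, jonesWenzl_idem]
    rfl
  simp only [project_apply, Category.assoc, jonesWenzl_idem]
  rw [← Category.assoc, h]

theorem project_eq_zero (hsplit : ∀ D : Diagram (a + b) c, ¬ D.IsSplit)
    (f : (⟨a + b⟩ : TL) ⟶ ⟨c⟩) : project a b c f = 0 := by
  induction f using hom_induction with
  | zero => rw [map_zero]
  | add f g hf hg => rw [map_add, hf, hg, add_zero]
  | smul s f hf => rw [map_smul, hf, smul_zero]
  | diagram D => exact project_ofDiagram_of_not_isSplit (hsplit D)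

theorem exists_project_eq_smul {D : Diagram (a + b) c} (hD : D.IsSplit)
    (f : (⟨a + b⟩ : TL) ⟶ ⟨c⟩) :
    ∃ s : GroundField, s • project a b c (ofDiagram D) = project a b c f := by
  induction f using hom_induction with
  | zero => exact ⟨0, by rw [map_zero, zero_smul]⟩
  | add f g hf hg =>
    obtain ⟨s, hs⟩ := hf
    obtain ⟨t, ht⟩ := hg
    exact ⟨s + t, by rw [add_smul, map_add, hs, ht]⟩
  | smul s f hf =>
    obtain ⟨t, ht⟩ := hf
    exact ⟨s * t, by rw [mul_smul, map_smul, ht]⟩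
  | diagram E =>
    by_cases hE : E.IsSplit
    · exact ⟨1, by rw [one_smul, hD.eq hE]⟩
    · exact ⟨0, by rw [zero_smul, project_ofDiagram_of_not_isSplit hE]⟩

end Projection

end TL

/-! ### Morphism spaces of the Karoubi envelope -/

section KaroubiHom

open TL

variable {a b c : ℕ}

theorem project_karoubiHom
    (f : karoubiTensor (jonesWenzlObj jonesWenzl_idem a) (jonesWenzlObj jonesWenzl_idem b) ⟶
      jonesWenzlObj jonesWenzl_idem c) : project a b c f.f = f.f := f.comm

theorem karoubiHom_eq_zero (h : ¬ Admissible a b c)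
    (f : karoubiTensor (jonesWenzlObj jonesWenzl_idem a) (jonesWenzlObj jonesWenzl_idem b) ⟶
      jonesWenzlObj jonesWenzl_idem c) : f = 0 := by
  refine Idempotents.Karoubi.hom_ext _ _ ?_
  rw [← project_karoubiHom f]
  exact project_eq_zero (fun D hD => h hD.admissible) f.f

theorem finrank_karoubiHom (h : Admissible a b c) : Module.finrank GroundField
    (karoubiTensor (jonesWenzlObj jonesWenzl_idem a) (jonesWenzlObj jonesWenzl_idem b) ⟶
      jonesWenzlObj jonesWenzl_idem c) = 1 := by
  obtain ⟨D, hD⟩ := Diagram.exists_isSplit h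
  let v : karoubiTensor (jonesWenzlObj jonesWenzl_idem a) (jonesWenzlObj jonesWenzl_idem b) ⟶
      jonesWenzlObj jonesWenzl_idem c := ⟨project a b c (ofDiagram D), project_project _⟩
  refine finrank_eq_one v (fun hv => ?_) fun f => ?_
  · exact project_ofDiagram_ne_zero hD (congrArg Idempotents.Karoubi.Hom.f hv)
  · obtain ⟨s, hs⟩ := exists_project_eq_smul hD f.f
    refine ⟨s, Idempotents.Karoubi.hom_ext _ _ ?_⟩
    exact hs.trans (project_karoubiHom f)

end KaroubiHom

end TemperleyLieb

theorem mainTheorem3 :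
    ∃ h : ∀ n : ℕ, TL.jonesWenzl n ≫ TL.jonesWenzl n = TL.jonesWenzl n,
      ∀ a b c : ℕ,
        (Module.finrank GroundField
            (karoubiTensor (jonesWenzlObj h a) (jonesWenzlObj h b) ⟶ jonesWenzlObj h c) = 1 ↔
          Admissible a b c) ∧
        (¬ Admissible a b c →
          ∀ f : karoubiTensor (jonesWenzlObj h a) (jonesWenzlObj h b) ⟶ jonesWenzlObj h c,
            f = 0) := by
  refine ⟨TL.jonesWenzl_idem, fun a b c => ⟨⟨fun h => ?_, finrank_karoubiHom⟩,
    karoubiHom_eq_zero⟩⟩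
  by_contra hadm
  have := subsingleton_of_forall_eq 0 (karoubiHom_eq_zero hadm)
  rw [Module.finrank_zero_of_subsingleton] at h
  exact zero_ne_one h
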